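/- **Setting.** Let $\Phi,\varphi$ be the standard normal distribution function and density and $\Phi^{-1}$ the quantile function. Let $\mathbf Z=(Z_t)_{t\in[0,1]}$ be a process with continuous paths such that, for some constant $m\ge 1$, almost surely $0\le Z_t\le m$ for all $t\in[0,1]$, and $E(Z_t)=1$ for every $t\in[0,1]$. Let $\delta\in(0,1]$, and let $\Theta\subset\mathbb R$ be open with $0\in\Theta$. Let $\{H_\vartheta:\vartheta\in\Theta\}$ be probability distributions on $[0,\infty)$ such that $H_0$ is the uniform distribution on $(0,1)$ and such that, for some $u_0\in(0,1)$, every $H_\vartheta$ has on $[0,u_0]$ a density $$h_\vartheta(u)=1+\vartheta u^\delta+r_\vartheta(u),\qquad r_\vartheta(0)=0,$$ where, for some $\varepsilon_0>0$, $\sup_{\vartheta\in\Theta,\,0<|\vartheta|\le\varepsilon_0}|r_\vartheta(u)/(\vartheta u^\delta)|\to0$ as $u\downarrow0$. Assume $A:=E(\inf_{t\in[0,1]}Z_t)>0$ and put $B:=E(\inf_{t\in[0,1]}Z_t^{1+\delta})$. Fix $M<0$. Under $P_\vartheta$, $\vartheta\in\Theta$, let $(W_i,\mathbf Z^{(i)})$,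 $i\ge1$, be independent copies of $(W,\mathbf Z)$, where $W\sim H_\vartheta$ is independent of $\mathbf Z$ and the law of $\mathbf Z$ does not depend on $\vartheta$. Put $X^{(i)}_t=\max(-W_i/Z^{(i)}_t,M)$, read as $M$ when $Z^{(i)}_t=0$. For $c<0$ let $Y_1,\dots,Y_{\tau(n)}$ be those among the values $\sup_{t\in[0,1]}(X^{(i)}_t/c)$, $i\le n$, that are at most $1$, in their order of occurrence; $\tau(n)$ is their number. With $c=c_n$ define $$T_{n,c_n}=\frac1{\tau(n)^{1/2}}\sum_{k\le\tau(n)}\Phi^{-1}(Y_k),\qquad S_{n,c_n}=\frac{(2\delta+1)^{1/2}}{1+\delta}(Z_{n1}+Z_{n2}),$$ $$Z_{n1}=\frac{\tau(n)-n|c_n|A}{(n|c_n|A)^{1/2}},\qquad Z_{n2}=\frac{1+\delta}{\tau(n)^{1/2}}\sum_{k\le\tau(n)}\Bigl(Y_k^\delta-\frac1{1+\delta}\Bigr),$$ where $T_{n,c_n}$ and $Z_{n2}$ are set to $0$ if $\tau(n)=0$. Let $c_n<0$, $c_n\to0$ and $n|c_n|^{1+2\delta}\to\infty$ as $n\to\infty$.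 For $\xi\in\mathbb R$ put $\vartheta_n(\xi)=\xi/(n|c_n|^{1+2\delta})^{1/2}$, which lies in $\Theta$ for all large $n$, and put $I_\delta:=\int_{-\infty}^\infty x\,\Phi(x)^\delta\varphi(x)\,dx$. For $\alpha\in(0,1)$ let $u_\alpha=\Phi^{-1}(1-\alpha)$. **Proposition 2.3.** (i) For every $\xi\in\mathbb R$, under $P_{\vartheta_n(\xi)}$, $$T_{n,c_n}\to_{D}N\left(\xi\,\frac{B}{A^{1/2}}\,I_\delta,\;1\right).$$ (ii) For all $\alpha\in(0,1)$ and $\xi\ge0$, $$P_{\vartheta_n(\xi)}(T_{n,c_n}>u_\alpha)\to1-\Phi\Bigl(u_\alpha-|\xi|\tfrac{B}{A^{1/2}}I_\delta\Bigr),\qquad P_{\vartheta_n(\xi)}(S_{n,c_n}>u_\alpha)\to1-\Phi\Bigl(u_\alpha-\tfrac{|\xi|B}{A^{1/2}(2\delta+1)^{1/2}}\Bigr).$$ For $\xi\le0$ the same limits hold for $P_{\vartheta_n(\xi)}(T_{n,c_n}<-u_\alpha)$ and $P_{\vartheta_n(\xi)}(S_{n,c_n}<-u_\alpha)$, respectively.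 (iii) Consequently, for every $\xi\neq0$, the asymptotic relative efficiency of the one-sided tests based on $T_{n,c_n}$ with respect to those based on $S_{n,c_n}$ (upper tests if $\xi>0$, lower tests if $\xi<0$), that is, the ratio of the squares of the shifts $d$ in their asymptotic power functions $\alpha\mapsto1-\Phi(u_\alpha-d)$, is well defined and equals $$(2\delta+1)\left(\int_{-\infty}^\infty x\,\Phi(x)^\delta\varphi(x)\,dx\right)^2 ,$$ independently of $\xi$, and this number is positive. -/

import Mathlib

open MeasureTheory ProbabilityTheory Filter Topology Set unitInterval

noncomputable section

namespace GPProcess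

/-- The standard normal distribution function `Φ`. -/
def Phi (x : ℝ) : ℝ := cdf (gaussianReal 0 1) x

/-- The standard normal density `φ`. -/
def phi (x : ℝ) : ℝ := gaussianPDFReal 0 1 x

/-- The standard normal quantile function `Φ⁻¹` on `(0,1)`. Outside `(0,1)` the value is `0`;
the observations take such values with probability zero. -/
def PhiInv (u : ℝ) : ℝ := sInf {x : ℝ | u ≤ Phi x}

/-- `Q` is the law on `C[0,1]` of a generator: a process `Z` with continuous paths,
`0 ≤ Z_t ≤ m` and `E(Z_t) = 1`, where `m ≥ 1`. -/
structure IsGeneratorLaw [MeasurableSpace C(I, ℝ)] (Q : Measure C(I, ℝ)) (m : ℝ) : Prop where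
  isProbabilityMeasure : IsProbabilityMeasure Q
  one_le : 1 ≤ m
  bounded : ∀ᵐ z ∂Q, ∀ t : I, 0 ≤ z t ∧ z t ≤ m
  mean_eq_one : ∀ t : I, ∫ z, z t ∂Q = 1

/-- `A = E(inf_t Z_t)`. -/
def constA [MeasurableSpace C(I, ℝ)] (Q : Measure C(I, ℝ)) : ℝ :=
  ∫ z, ⨅ t : I, z t ∂Q

/-- `B = E(inf_t Z_t^(1+δ))`. -/
def constB [MeasurableSpace C(I, ℝ)] (Q : Measure C(I, ℝ)) (δ : ℝ) : ℝ :=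
  ∫ z, ⨅ t : I, (z t) ^ (1 + δ) ∂Q

/-- The family `H_ϑ`, `ϑ ∈ Θ`, of laws of `W ≥ 0`: `H_0` is uniform on `(0,1)`, and on `[0,u₀]`
the law `H_ϑ` has a density `h_ϑ(u) = 1 + ϑ u^δ + r_ϑ(u)` with `r_ϑ(0) = 0` and
`sup_{0 < |ϑ| ≤ ε₀} |r_ϑ(u) / (ϑ u^δ)| → 0` as `u ↓ 0`. Nothing is required of `H ϑ`
for `ϑ ∉ Θ`. -/
structure IsDeltaFamily (δ : ℝ) (Θ : Set ℝ) (H : ℝ → Measure ℝ) (h r : ℝ → ℝ → ℝ)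
    (u₀ ε₀ : ℝ) : Prop where
  delta_mem : δ ∈ Ioc (0 : ℝ) 1
  isOpen : IsOpen Θ
  zero_mem : (0 : ℝ) ∈ Θ
  isProbabilityMeasure : ∀ ϑ ∈ Θ, IsProbabilityMeasure (H ϑ)
  nonneg : ∀ ϑ ∈ Θ, H ϑ (Iio 0) = 0
  uniform : H 0 = volume.restrict (Ioo 0 1)
  u₀_mem : u₀ ∈ Ioo (0 : ℝ) 1
  density_aemeasurable : ∀ ϑ ∈ Θ, AEMeasurable (h ϑ) (volume.restrict (Icc 0 u₀))
  density_nonneg : ∀ ϑ ∈ Θ, ∀ u ∈ Icc 0 u₀, 0 ≤ h ϑ u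
  density : ∀ ϑ ∈ Θ, (H ϑ).restrict (Icc 0 u₀) =
    (volume.restrict (Icc 0 u₀)).withDensity (fun u => ENNReal.ofReal (h ϑ u))
  expansion : ∀ ϑ ∈ Θ, ∀ u ∈ Icc 0 u₀, h ϑ u = 1 + ϑ * u ^ δ + r ϑ u
  remainder_zero : ∀ ϑ ∈ Θ, r ϑ 0 = 0
  ε₀_pos : 0 < ε₀
  remainder : TendstoUniformlyOn (fun u ϑ => r ϑ u / (ϑ * u ^ δ)) (fun _ => 0) (𝓝[>] 0)
    {ϑ | ϑ ∈ Θ ∧ 0 < |ϑ| ∧ |ϑ| ≤ ε₀}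

/-- Under `P` the pairs `(W_i, Z_i)` are independent copies of a pair `(W, Z)` of independent
variables with laws `H` and `Q`. -/
structure IsSample [MeasurableSpace C(I, ℝ)] {Ω : Type*} [MeasurableSpace Ω] (P : Measure Ω)
    (H : Measure ℝ) (Q : Measure C(I, ℝ)) (W : ℕ → Ω → ℝ) (Z : ℕ → Ω → C(I, ℝ)) : Prop where
  law_W : ∀ i, HasLaw (W i) H P
  law_Z : ∀ i, HasLaw (Z i) Q P
  indep : ∀ i, IndepFun (W i) (Z i) P
  iIndep : iIndepFun (fun i ω => (W i ω, Z i ω)) P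

/-- The process `X_t = max(-W / Z_t, M)`, where `-W / 0` is read as `-∞`, that is, `X_t = M`
if `Z_t = 0`. -/
def procX (M w : ℝ) (z : C(I, ℝ)) (t : I) : ℝ :=
  if z t = 0 then M else max (-w / z t) M

/-- `sup_t (X_t / c)`, for `c < 0`. -/
def supRatio (M c w : ℝ) (z : C(I, ℝ)) : ℝ := ⨆ t : I, procX M w z t / c

/-- For the values `s i = sup_t (X^{(i)}_t / c)`: the indices of the exceedances (`s i ≤ 1`)
among the first `n` observations. The `Y_1, …, Y_τ` are the values `s i` at these indices. -/
def exceedances (s : ℕ → ℝ) (n : ℕ) : Finset ℕ := (Finset.range n).filter (fun i => s i ≤ 1)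

/-- The number `τ(n)` of exceedances. -/
def tau (s : ℕ → ℝ) (n : ℕ) : ℕ := (exceedances s n).card

/-- The omnibus statistic `τ(n)^{-1/2} Σ_{k ≤ τ(n)} Φ⁻¹(Y_k)` (it is `0` if `τ(n) = 0`). -/
def omnibus (s : ℕ → ℝ) (n : ℕ) : ℝ :=
  (1 / √(tau s n : ℝ)) * ∑ i ∈ exceedances s n, PhiInv (s i)

/-- `Z_{n1} = (τ(n) - n|c|A) / (n|c|A)^{1/2}`. -/
def centralOne (A c : ℝ) (s : ℕ → ℝ) (n : ℕ) : ℝ :=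
  ((tau s n : ℝ) - n * |c| * A) / √(n * |c| * A)

/-- `Z_{n2} = (1+δ) τ(n)^{-1/2} Σ_{k ≤ τ(n)} (Y_k^δ - 1/(1+δ))` (it is `0` if `τ(n) = 0`). -/
def centralTwo (δ : ℝ) (s : ℕ → ℝ) (n : ℕ) : ℝ :=
  ((1 + δ) / √(tau s n : ℝ)) * ∑ i ∈ exceedances s n, ((s i) ^ δ - 1 / (1 + δ))

/-- The standardized statistic `(2δ+1)^{1/2} / (1+δ) · (Z_{n1} + Z_{n2})` of the optimal tests. -/
def optimal (δ A c : ℝ) (s : ℕ → ℝ) (n : ℕ) : ℝ :=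
  √(2 * δ + 1) / (1 + δ) * (centralOne A c s n + centralTwo δ s n)

/-- The alternatives `ϑ_n(ξ) = ξ / (n |c_n|^{1+2δ})^{1/2}`. -/
def alternative (δ : ℝ) (c : ℕ → ℝ) (ξ : ℝ) (n : ℕ) : ℝ :=
  ξ / √(n * |c n| ^ (1 + 2 * δ))

/-- The constant `∫ x Φ(x)^δ φ(x) dx`. -/
def normalInt (δ : ℝ) : ℝ := ∫ x : ℝ, x * Phi x ^ δ * phi x

/-- The values `sup_t (X^{(i)}_t / c)` in the sample. -/
def obs {Ω : Type*} (M c : ℝ) (W : ℕ → Ω → ℝ) (Z : ℕ → Ω → C(I, ℝ)) (ω : Ω) (i : ℕ) : ℝ :=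
  supRatio M c (W i ω) (Z i ω)

/-- The omnibus statistic `T_{n,c_n}` as a random variable. -/
def T {Ω : Type*} (M : ℝ) (c : ℕ → ℝ) (W : ℕ → Ω → ℝ) (Z : ℕ → Ω → C(I, ℝ)) (n : ℕ) (ω : Ω) : ℝ :=
  omnibus (obs M (c n) W Z ω) n

/-- The statistic of the optimal tests, based on `N_{n,c_n}`, as a random variable. -/
def S {Ω : Type*} (δ A M : ℝ) (c : ℕ → ℝ) (W : ℕ → Ω → ℝ) (Z : ℕ → Ω → C(I, ℝ)) (n : ℕ)
    (ω : Ω) : ℝ :=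
  optimal δ A (c n) (obs M (c n) W Z ω) n

/-- The power at sample size `n`, under the laws `μ n`, of the upper one-sided test that rejects
if `stat n > u_α`, where `u_α = Φ⁻¹(1-α)`. -/
def upperPower {Ω : Type*} [MeasurableSpace Ω] (μ : ℕ → Measure Ω) (stat : ℕ → Ω → ℝ)
    (α : ℝ) (n : ℕ) : ℝ :=
  (μ n).real {ω | PhiInv (1 - α) < stat n ω}

/-- The power at sample size `n`, under the laws `μ n`, of the lower one-sided test that rejects
if `stat n < -u_α`. -/
def lowerPower {Ω : Type*} [MeasurableSpace Ω] (μ : ℕ → Measure Ω) (stat : ℕ → Ω → ℝ)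
    (α : ℝ) (n : ℕ) : ℝ :=
  (μ n).real {ω | stat n ω < -PhiInv (1 - α)}

/-- For each level `α ∈ (0,1)` the power converges to `1 - Φ(u_α - d)`. The shift `d` is
determined by this. -/
def HasShift (power : ℝ → ℕ → ℝ) (d : ℝ) : Prop :=
  ∀ α ∈ Ioo (0 : ℝ) 1, Tendsto (power α) atTop (𝓝 (1 - Phi (PhiInv (1 - α) - d)))

/-- `e` is the asymptotic relative efficiency of a sequence of tests with power function `power'`
with respect to one with power function `power`: the ratio of the squared shifts of the asymptotic
power functions. -/
def IsARE (power' power : ℝ → ℕ → ℝ) (e : ℝ) : Prop :=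
  ∃ d' d : ℝ, HasShift power' d' ∧ HasShift power d ∧ d ≠ 0 ∧ e = d' ^ 2 / d ^ 2

end GPProcess

end

/-! For `c` so close to `0` that `M < c`, the cut-off at `M` is harmless: observation `i` is an
exceedance exactly if `W ≤ |c| inf Z`, almost surely, and its value is then `W / (|c| inf Z)`.
Substituting in the density of `W` near the origin and averaging over `Z` gives, for bounded `ψ`,
`E[ψ(Y); Y ≤ 1] = |c| A ∫ ψ + ϑ |c|^(1+δ) B ∫ ψ(y) y^δ dy + error`, all integrals over `(0,1]`; the
error is a small multiple of `|ϑ| |c|^(1+δ) B ∫ ‖ψ‖` (`exists_integral_exceedance_expansion`).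

Put `a = √(n|c|A)`. The choice `ψ = exp(itg/a) - 1` describes the characteristic function of one
summand of `Σ g(Y_k)/a`. Since `n|c|A = a²` and `n ϑ_n |c|^(1+δ) = (ξ/√A) a`, a second order Taylor
expansion in the first term and a first order one in the second show that `Σ g(Y_k)/a - a ∫ g`
converges to `N(ξ (B/√A) ∫ g y^δ, ∫ g²)` (`charFunTendsto_exceedance_sum`). The variance is not
centred because the number of terms is itself random, as for a Poisson sum.

Four choices of `g` suffice. The function `1` gives `τ/a² → 1` in probability; `Φ⁻¹` gives `T`;
`√(2δ+1) y^δ` gives the main part of `S`; its centred version controls the change from `√τ` to `a`.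
Slutsky's theorem joins them. The power limits follow since normal laws have no atoms, and the
common factor `|ξ|B/√A` cancels in the efficiency. -/

namespace GPProcess

/-! ### Weak convergence and convergence in probability under varying measures -/

section VaryingMeasures

variable {Ω : Type*} [MeasurableSpace Ω] {P : ℕ → Measure Ω} [∀ n, IsProbabilityMeasure (P n)]

/-- The real random variables `X n`, under the probability measures `P n`, have characteristic
functions converging pointwise to that of `ν`. -/
def CharFunTendsto (P : ℕ → Measure Ω) (X : ℕ → Ω → ℝ) (ν : Measure ℝ) : Prop :=
  ∀ t : ℝ, Tendsto (fun n => charFun ((P n).map (X n)) t) atTop (𝓝 (charFun ν t))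

/-- Convergence to zero in probability, under varying probability measures. -/
def NullInProb (P : ℕ → Measure Ω) (X : ℕ → Ω → ℝ) : Prop :=
  ∀ ε > 0, Tendsto (fun n => (P n).real {ω | ε ≤ |X n ω|}) atTop (𝓝 0)

lemma norm_exp_ofReal_mul_I_sub_le (x y : ℝ) :
    ‖Complex.exp (x * Complex.I) - Complex.exp (y * Complex.I)‖ ≤ |x - y| := by
  have h : Complex.exp (x * Complex.I) - Complex.exp (y * Complex.I)
      = Complex.exp (y * Complex.I) * (Complex.exp (Complex.I * ((x - y : ℝ) : ℂ)) - 1) := by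
    rw [mul_sub, ← Complex.exp_add, mul_one]
    congr 2
    push_cast
    ring
  rw [h, norm_mul, Complex.norm_exp_ofReal_mul_I, one_mul]
  exact Real.norm_exp_I_mul_ofReal_sub_one_le

/-- Where `|Y - X| < ε` the Lipschitz bound for `x ↦ exp(itx)` applies; elsewhere the integrand is
at most `2`. -/
lemma norm_charFun_sub_le {μ : Measure Ω} [IsProbabilityMeasure μ] {X Y : Ω → ℝ}
    (hX : Measurable X) (hY : Measurable Y) (t : ℝ) {ε : ℝ} (hε : 0 < ε) :
    ‖charFun (μ.map Y) t - charFun (μ.map X) t‖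
      ≤ |t| * ε + 2 * μ.real {ω | ε ≤ |Y ω - X ω|} := by
  have hS : MeasurableSet {ω | ε ≤ |Y ω - X ω|} :=
    measurableSet_le measurable_const ((hY.sub hX).abs)
  have int : ∀ {V : Ω → ℝ}, Measurable V →
      Integrable (fun ω => Complex.exp (t * V ω * Complex.I)) μ := fun {V} hV => by
    refine Integrable.of_bound (by fun_prop) 1 (ae_of_all _ fun ω => ?_)
    rw [← Complex.ofReal_mul, Complex.norm_exp_ofReal_mul_I]
  rw [charFun_apply_real, charFun_apply_real, integral_map hY.aemeasurable (by fun_prop),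
    integral_map hX.aemeasurable (by fun_prop), ← integral_sub (int hY) (int hX)]
  calc _ ≤ ∫ ω, |t| * ε + {ω | ε ≤ |Y ω - X ω|}.indicator (fun _ => (2 : ℝ)) ω ∂μ := by
        refine norm_integral_le_of_norm_le ?_ (ae_of_all _ fun ω => ?_)
        · exact (integrable_const _).add ((integrable_const _).indicator hS)
        · by_cases hω : ε ≤ |Y ω - X ω|
          · rw [indicator_of_mem (by exact hω)]
            refine (norm_sub_le _ _).trans ?_
            rw [← Complex.ofReal_mul, ← Complex.ofReal_mul, Complex.norm_exp_ofReal_mul_I,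
              Complex.norm_exp_ofReal_mul_I]
            have : 0 ≤ |t| * ε := by positivity
            linarith
          · rw [indicator_of_notMem (by exact hω), add_zero, ← Complex.ofReal_mul,
              ← Complex.ofReal_mul]
            refine (norm_exp_ofReal_mul_I_sub_le _ _).trans ?_
            rw [← mul_sub, abs_mul]
            gcongr
            exact (not_le.1 hω).le
    _ = _ := by
        rw [integral_add (integrable_const _) ((integrable_const _).indicator hS),
          integral_indicator_const _ hS]
        simp [mul_comm]

/-- **Slutsky's theorem** under varying probability measures. -/
lemma CharFunTendsto.of_sub {X Y : ℕ → Ω → ℝ} {ν : Measure ℝ} (hX : ∀ n, Measurable (X n))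
    (hY : ∀ n, Measurable (Y n)) (h : CharFunTendsto P X ν)
    (hXY : NullInProb P (fun n ω => Y n ω - X n ω)) : CharFunTendsto P Y ν := by
  intro t
  have key : Tendsto (fun n => charFun ((P n).map (Y n)) t - charFun ((P n).map (X n)) t)
      atTop (𝓝 0) := by
    rw [tendsto_zero_iff_norm_tendsto_zero, Metric.tendsto_atTop]
    intro ε hε
    -- The Lipschitz part is then at most `ε/2`; the probability, which counts twice, is made
    -- smaller than `ε/4`.
    have hδ : 0 < ε / (2 * (|t| + 1)) := by positivity
    have h2 := (hXY _ hδ).eventually (gt_mem_nhds (show (0 : ℝ) < ε / 4 by positivity))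
    obtain ⟨N, hN⟩ := eventually_atTop.1 h2
    refine ⟨N, fun n hn => ?_⟩
    have h3 := norm_charFun_sub_le (μ := P n) (hX n) (hY n) t hδ
    have h4 := hN n hn
    have h5 : |t| * (ε / (2 * (|t| + 1))) ≤ ε / 2 := by
      rw [← mul_div_assoc, div_le_div_iff₀ (by positivity) (by positivity)]
      nlinarith
    rw [Real.dist_eq, sub_zero, abs_norm]
    linarith
  simpa using key.add (h t)

/-- Convergence of characteristic functions to one continuous at `0` makes the laws of `X n` tight.
Outside an event `K < |X n|` of small probability, `|V n * X n| ≥ ε` forces `|V n| ≥ ε / K`. -/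
lemma NullInProb.mul_of_charFunTendsto {X V : ℕ → Ω → ℝ} {ν : Measure ℝ}
    [IsProbabilityMeasure ν] (hX : ∀ n, Measurable (X n))
    (h : CharFunTendsto P X ν) (hV : NullInProb P V) :
    NullInProb P (fun n ω => V n ω * X n ω) := by
  intro ε hε
  have : ∀ n, IsProbabilityMeasure ((P n).map (X n)) := fun n =>
    Measure.isProbabilityMeasure_map (hX n).aemeasurable
  have hcont : ContinuousAt (charFun ν) 0 := by
    have : Continuous (charFun ν) := by fun_prop
    exact this.continuousAt
  have tight := isTightMeasureSet_of_tendsto_charFun hcont h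
  have ht := tendsto_measure_norm_gt_of_isTightMeasureSet tight
  rw [Metric.tendsto_atTop]
  intro η hη
  have h1 := ht.eventually (gt_mem_nhds (show (0 : ENNReal) < ENNReal.ofReal (η / 2) by
    simpa using hη))
  obtain ⟨K, hK, hK0⟩ := (h1.and (eventually_gt_atTop (0 : ℝ))).exists
  have h2 := (hV (ε / K) (by positivity)).eventually
    (gt_mem_nhds (show (0 : ℝ) < η / 2 by positivity))
  obtain ⟨N, hN⟩ := eventually_atTop.1 h2
  refine ⟨N, fun n hn => ?_⟩
  have h3 : (P n).real {ω | K < |X n ω|} < η / 2 := by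
    have h4 : ((P n).map (X n)) {x | K < ‖x‖} < ENNReal.ofReal (η / 2) :=
      lt_of_le_of_lt (le_iSup₂ (f := fun (μ : Measure ℝ) (_ : μ ∈ range _) => μ {x | K < ‖x‖})
        ((P n).map (X n)) (mem_range_self n)) hK
    rw [Measure.map_apply (hX n) (measurableSet_lt measurable_const (by fun_prop))] at h4
    rw [Measure.real]
    exact (ENNReal.lt_ofReal_iff_toReal_lt (measure_ne_top _ _)).1 h4
  have h5 : {ω | ε ≤ |V n ω * X n ω|} ⊆ {ω | ε / K ≤ |V n ω|} ∪ {ω | K < |X n ω|} := by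
    intro ω hω
    by_contra hcon
    simp only [mem_union, mem_ofPred_eq, not_or, not_le, not_lt] at hcon hω
    rw [abs_mul] at hω
    have h6 : |V n ω| * |X n ω| ≤ |V n ω| * K := by gcongr; exact hcon.2
    have h7 := (lt_div_iff₀ hK0).1 hcon.1
    linarith
  have h8 := (measureReal_mono h5 (measure_ne_top (P n) _)).trans (measureReal_union_le _ _)
  have h9 := hN n hn
  rw [Real.dist_eq, sub_zero, abs_of_nonneg measureReal_nonneg]
  linarith

lemma CharFunTendsto.mul {X V : ℕ → Ω → ℝ} {ν : Measure ℝ} [IsProbabilityMeasure ν]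
    (hX : ∀ n, Measurable (X n)) (hV : ∀ n, Measurable (V n)) (h : CharFunTendsto P X ν)
    (hV1 : NullInProb P (fun n ω => V n ω - 1)) :
    CharFunTendsto P (fun n ω => V n ω * X n ω) ν := by
  refine h.of_sub hX (fun n => (hV n).mul (hX n)) ?_
  simpa only [sub_mul, one_mul] using hV1.mul_of_charFunTendsto hX h

omit [∀ n, IsProbabilityMeasure (P n)] in
lemma nullInProb_of_tendsto {b : ℕ → ℝ} (hb : Tendsto b atTop (𝓝 0)) :
    NullInProb P (fun n _ => b n) := by
  intro ε hε
  refine (tendsto_const_nhds (x := (0 : ℝ))).congr' ?_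
  have := (tendsto_zero_iff_abs_tendsto_zero _).1 hb
  filter_upwards [this.eventually (gt_mem_nhds hε)] with n hn
  have : {ω : Ω | ε ≤ |b n|} = ∅ := by
    ext ω
    simpa using hn
  simp [this]

lemma NullInProb.comp_continuousAt {V : ℕ → Ω → ℝ} {f : ℝ → ℝ} {x : ℝ}
    (hV : NullInProb P (fun n ω => V n ω - x)) (hf : ContinuousAt f x) :
    NullInProb P (fun n ω => f (V n ω) - f x) := by
  intro ε hε
  obtain ⟨η, hη, hf'⟩ := Metric.continuousAt_iff.1 hf ε hε
  refine squeeze_zero (fun _ => measureReal_nonneg) (fun n => ?_) (hV η hη)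
  refine measureReal_mono (fun ω hω => ?_) (measure_ne_top _ _)
  simp only [mem_ofPred_eq] at hω ⊢
  by_contra hcon
  have := hf' (x := V n ω) (by simpa [Real.dist_eq] using hcon)
  rw [Real.dist_eq] at this
  linarith

lemma CharFunTendsto.tendstoInDistribution {X : ℕ → Ω → ℝ} {ν : Measure ℝ}
    [IsProbabilityMeasure ν] (hX : ∀ n, Measurable (X n)) (h : CharFunTendsto P X ν) :
    TendstoInDistribution X atTop (id : ℝ → ℝ) P ν where
  forall_aemeasurable n := (hX n).aemeasurable
  tendsto := by
    refine ProbabilityMeasure.tendsto_iff_tendsto_charFun.2 fun t => ?_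
    simpa using h t

lemma tendsto_real_of_tendstoInDistribution {X : ℕ → Ω → ℝ} {ν : Measure ℝ}
    [IsProbabilityMeasure ν] (hX : ∀ n, Measurable (X n))
    (h : TendstoInDistribution X atTop (id : ℝ → ℝ) P ν) {s : Set ℝ} (hs : MeasurableSet s)
    (hν : ν (frontier s) = 0) :
    Tendsto (fun n => (P n).real (X n ⁻¹' s)) atTop (𝓝 (ν.real s)) := by
  have h1 := ProbabilityMeasure.tendsto_measure_of_null_frontier_of_tendsto' h.tendsto
    (E := s) (by simpa using hν)
  have h2 := (ENNReal.tendsto_toReal (by simp)).comp h1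
  simp only [ProbabilityMeasure.coe_mk, Measure.map_id] at h2
  refine h2.congr fun n => ?_
  simp [Measure.map_apply (hX n) hs, Measure.real]

end VaryingMeasures

/-! ### Estimates for complex powers and exponentials -/

lemma norm_pow_sub_pow_le_of_norm_le_one {x y : ℂ} (hx : ‖x‖ ≤ 1) (hy : ‖y‖ ≤ 1) (n : ℕ) :
    ‖x ^ n - y ^ n‖ ≤ n * ‖x - y‖ := by
  induction n with
  | zero => simp
  | succ n ih =>
    have h : x ^ (n + 1) - y ^ (n + 1) = x * (x ^ n - y ^ n) + (x - y) * y ^ n := by ring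
    rw [h]
    refine (norm_add_le _ _).trans ?_
    rw [norm_mul, norm_mul, norm_pow]
    have h1 : ‖x‖ * ‖x ^ n - y ^ n‖ ≤ 1 * (n * ‖x - y‖) := by gcongr
    have h2 : ‖x - y‖ * ‖y‖ ^ n ≤ ‖x - y‖ * 1 := by
      gcongr
      exact pow_le_one₀ (norm_nonneg _) hy
    push_cast
    linarith

/-- The bound `‖1 + w‖ ≤ 1` forces `Re w ≤ 0`, so `exp w` lies in the unit disc as well. Powers of
points of the disc differ by at most `n` times the points, and `exp w - 1 - w` is of order `‖w‖²`.
-/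
lemma norm_one_add_pow_sub_exp_le {w : ℂ} (hw : ‖w‖ ≤ 1) (hw' : ‖1 + w‖ ≤ 1) (n : ℕ) :
    ‖(1 + w) ^ n - Complex.exp (n * w)‖ ≤ n * ‖w‖ ^ 2 := by
  have hre : w.re ≤ 0 := by
    have := (Complex.re_le_norm (1 + w)).trans hw'
    simp only [Complex.add_re, Complex.one_re] at this
    linarith
  have hexp : ‖Complex.exp w‖ ≤ 1 := by
    rw [Complex.norm_exp]
    exact Real.exp_le_one_iff.2 hre
  rw [Complex.exp_nat_mul]
  refine (norm_pow_sub_pow_le_of_norm_le_one hw' hexp n).trans ?_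
  gcongr
  rw [norm_sub_rev, show Complex.exp w - (1 + w) = Complex.exp w - 1 - w by ring]
  exact Complex.norm_exp_sub_one_sub_id_le hw

/-- Being valid for all real `x`, this supplies the dominating function for unbounded `g`. For `|x|
> 1` the crude bound `2|x|` is already below `2x²`. -/
lemma norm_exp_I_mul_sub_one_sub_le (x : ℝ) :
    ‖Complex.exp (Complex.I * x) - 1 - Complex.I * x‖ ≤ 2 * x ^ 2 := by
  have hx : ‖Complex.I * (x : ℂ)‖ = |x| := by simp
  rcases le_or_gt |x| 1 with h | h
  · have := Complex.norm_exp_sub_one_sub_id_le (x := Complex.I * x) (by rw [hx]; exact h)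
    rw [hx, sq_abs] at this
    nlinarith [sq_nonneg x]
  · refine (norm_sub_le _ _).trans ?_
    rw [hx]
    have := Real.norm_exp_I_mul_ofReal_sub_one_le (x := x)
    rw [Real.norm_eq_abs] at this
    nlinarith [sq_abs x]

lemma norm_exp_I_mul_taylor_le {x : ℝ} (hx : |x| ≤ 1) :
    ‖Complex.exp (Complex.I * x) - 1 - Complex.I * x + x ^ 2 / 2‖ ≤ |x| ^ 3 := by
  have hx' : ‖Complex.I * (x : ℂ)‖ = |x| := by simp
  have h := Complex.exp_bound (x := Complex.I * x) (by rw [hx']; exact hx) (n := 3) (by norm_num)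
  rw [hx'] at h
  have h2 : Complex.exp (Complex.I * x) - 1 - Complex.I * x + x ^ 2 / 2
      = Complex.exp (Complex.I * x) - ∑ m ∈ Finset.range 3, (Complex.I * (x : ℂ)) ^ m / m.factorial := by
    simp only [Finset.sum_range_succ, Finset.range_zero, Finset.sum_empty, mul_pow, Complex.I_sq]
    norm_num [Nat.factorial]
    ring
  rw [h2]
  refine h.trans (mul_le_of_le_one_right (by positivity) ?_)
  norm_num [Nat.factorial]

lemma tendsto_sq_mul_exp_sub (s : ℝ) :
    Tendsto (fun a : ℝ => (a : ℂ) ^ 2 * (Complex.exp (Complex.I * ((s / a : ℝ) : ℂ)) - 1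
      - Complex.I * ((s / a : ℝ) : ℂ))) atTop (𝓝 ((-(s ^ 2 / 2) : ℝ) : ℂ)) := by
  rw [tendsto_iff_norm_sub_tendsto_zero]
  have hz : Tendsto (fun a : ℝ => |s| ^ 3 / a) atTop (𝓝 0) := tendsto_const_nhds.div_atTop tendsto_id
  refine squeeze_zero' (Eventually.of_forall fun _ => norm_nonneg _) ?_ hz
  filter_upwards [eventually_ge_atTop |s|, eventually_gt_atTop 0] with a ha ha0
  have h1 : |s / a| ≤ 1 := by rwa [abs_div, abs_of_pos ha0, div_le_one ha0]
  have h2 := norm_exp_I_mul_taylor_le h1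
  have hac : (a : ℂ) ≠ 0 := by exact_mod_cast ha0.ne'
  have h3 : (a : ℂ) ^ 2 * (Complex.exp (Complex.I * ((s / a : ℝ) : ℂ)) - 1
      - Complex.I * ((s / a : ℝ) : ℂ)) - ((-(s ^ 2 / 2) : ℝ) : ℂ)
      = (a : ℂ) ^ 2 * (Complex.exp (Complex.I * ((s / a : ℝ) : ℂ)) - 1
      - Complex.I * ((s / a : ℝ) : ℂ) + ((s / a : ℝ) : ℂ) ^ 2 / 2) := by
    push_cast
    field_simp
    ring
  rw [h3, norm_mul, norm_pow, Complex.norm_real, Real.norm_eq_abs, abs_of_pos ha0]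
  calc a ^ 2 * _ ≤ a ^ 2 * |s / a| ^ 3 := by gcongr
    _ = |s| ^ 3 / a := by
      rw [abs_div, abs_of_pos ha0]
      field_simp

lemma tendsto_mul_exp_sub (s : ℝ) :
    Tendsto (fun a : ℝ => (a : ℂ) * (Complex.exp (Complex.I * ((s / a : ℝ) : ℂ)) - 1))
      atTop (𝓝 (Complex.I * s)) := by
  rw [tendsto_iff_norm_sub_tendsto_zero]
  have hz : Tendsto (fun a : ℝ => 2 * s ^ 2 / a) atTop (𝓝 0) :=
    tendsto_const_nhds.div_atTop tendsto_id
  refine squeeze_zero' (Eventually.of_forall fun _ => norm_nonneg _) ?_ hz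
  filter_upwards [eventually_gt_atTop 0] with a ha0
  have hac : (a : ℂ) ≠ 0 := by exact_mod_cast ha0.ne'
  have h3 : (a : ℂ) * (Complex.exp (Complex.I * ((s / a : ℝ) : ℂ)) - 1) - Complex.I * s
      = (a : ℂ) * (Complex.exp (Complex.I * ((s / a : ℝ) : ℂ)) - 1
        - Complex.I * ((s / a : ℝ) : ℂ)) := by
    push_cast
    field_simp
  rw [h3, norm_mul, Complex.norm_real, Real.norm_eq_abs, abs_of_pos ha0]
  calc a * _ ≤ a * (2 * (s / a) ^ 2) := by gcongr; exact norm_exp_I_mul_sub_one_sub_le _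
    _ = 2 * s ^ 2 / a := by field_simp

/-! ### Taylor limits under the integral sign -/

section Limits

variable {α : Type*} [MeasurableSpace α] {μ : Measure α} {g : α → ℝ}

/-- Dominated convergence with the majorant `2 t² g²`, free of `a`; no moment beyond the second is
needed, and `Φ⁻¹` is admitted. -/
lemma tendsto_integral_sq_mul_exp_sub (hg : Measurable g) (hg2 : Integrable (fun y => g y ^ 2) μ)
    (t : ℝ) :
    Tendsto (fun a : ℝ => ∫ y, (a : ℂ) ^ 2 * (Complex.exp (Complex.I * ((t * g y / a : ℝ) : ℂ)) - 1
      - Complex.I * ((t * g y / a : ℝ) : ℂ)) ∂μ) atTop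
      (𝓝 ((-(t ^ 2 / 2 * ∫ y, g y ^ 2 ∂μ) : ℝ) : ℂ)) := by
  have hlim : ((-(t ^ 2 / 2 * ∫ y, g y ^ 2 ∂μ) : ℝ) : ℂ)
      = ∫ y, ((-((t * g y) ^ 2 / 2) : ℝ) : ℂ) ∂μ := by
    rw [integral_complex_ofReal]
    congr 1
    rw [← integral_const_mul, ← integral_neg]
    congr with y
    ring
  rw [hlim]
  refine tendsto_integral_filter_of_dominated_convergence (fun y => 2 * t ^ 2 * g y ^ 2) ?_ ?_
    (hg2.const_mul _) (ae_of_all _ fun y => tendsto_sq_mul_exp_sub (t * g y))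
  · exact Eventually.of_forall fun a => Measurable.aestronglyMeasurable (by fun_prop)
  · filter_upwards [eventually_gt_atTop 0] with a ha
    refine ae_of_all _ fun y => ?_
    rw [norm_mul, norm_pow, Complex.norm_real, Real.norm_eq_abs, sq_abs]
    calc a ^ 2 * _ ≤ a ^ 2 * (2 * (t * g y / a) ^ 2) := by
          gcongr
          exact norm_exp_I_mul_sub_one_sub_le _
      _ = 2 * t ^ 2 * g y ^ 2 := by field_simp

lemma norm_mul_exp_sub_le {a : ℝ} (ha : 0 < a) (s : ℝ) :
    a * ‖Complex.exp (Complex.I * ((s / a : ℝ) : ℂ)) - 1‖ ≤ |s| := by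
  calc a * _ ≤ a * |s / a| := by
        gcongr
        exact Real.norm_exp_I_mul_ofReal_sub_one_le
    _ = |s| := by
        rw [abs_div, abs_of_pos ha]
        field_simp

lemma tendsto_integral_mul_exp_sub (hg : Measurable g) (hg1 : Integrable g μ) {k : α → ℝ}
    (hk : Measurable k) (hk1 : ∀ᵐ y ∂μ, |k y| ≤ 1) (t : ℝ) :
    Tendsto (fun a : ℝ => (a : ℂ) * ∫ y, (Complex.exp (Complex.I * ((t * g y / a : ℝ) : ℂ)) - 1)
      * (k y : ℂ) ∂μ) atTop (𝓝 (Complex.I * ((t * ∫ y, g y * k y ∂μ : ℝ) : ℂ))) := by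
  have hlim : Complex.I * ((t * ∫ y, g y * k y ∂μ : ℝ) : ℂ)
      = ∫ y, Complex.I * ((t * g y : ℝ) : ℂ) * (k y : ℂ) ∂μ := by
    rw [← integral_const_mul, ← integral_complex_ofReal, ← integral_const_mul]
    congr with y
    push_cast
    ring
  rw [hlim]
  simp_rw [← integral_const_mul, ← mul_assoc]
  refine tendsto_integral_filter_of_dominated_convergence (fun y => |t| * |g y|) ?_ ?_
    (hg1.abs.const_mul _) (ae_of_all _ fun y => (tendsto_mul_exp_sub (t * g y)).mul_const _)
  · exact Eventually.of_forall fun a => Measurable.aestronglyMeasurable (by fun_prop)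
  · filter_upwards [eventually_gt_atTop 0] with a ha
    filter_upwards [hk1] with y hy
    rw [norm_mul, norm_mul, Complex.norm_real, Complex.norm_real, Real.norm_eq_abs,
      Real.norm_eq_abs, abs_of_pos ha, ← abs_mul]
    refine (mul_le_of_le_one_right (by positivity) hy).trans (norm_mul_exp_sub_le ha _)

/-- Keeps the remainder of the density expansion bounded after multiplication by a factor of order
`a`. -/
lemma mul_integral_norm_exp_sub_le (hg1 : Integrable g μ) (t : ℝ) {a : ℝ} (ha : 0 < a) :
    a * ∫ y, ‖Complex.exp (Complex.I * ((t * g y / a : ℝ) : ℂ)) - 1‖ ∂μ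
      ≤ |t| * ∫ y, |g y| ∂μ := by
  rw [← integral_const_mul, ← integral_const_mul]
  refine integral_mono_of_nonneg (ae_of_all _ fun y => by positivity) (hg1.abs.const_mul _)
    (ae_of_all _ fun y => ?_)
  simpa only [abs_mul] using norm_mul_exp_sub_le ha (t * g y)

end Limits

/-! ### The laws `H ϑ` near the origin -/

lemma setIntegral_Ioc_comp_div {E : Type*} [NormedAddCommGroup E] [NormedSpace ℝ E]
    (F : ℝ → E) {b : ℝ} (hb : 0 < b) :
    ∫ u in Ioc 0 b, F (u / b) = b • ∫ y in Ioc 0 1, F y := by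
  rw [← intervalIntegral.integral_of_le hb.le, ← intervalIntegral.integral_of_le zero_le_one,
    intervalIntegral.integral_comp_div _ hb.ne', zero_div, div_self hb.ne']

lemma rpow_le_one_of_mem_Ioc {δ y : ℝ} (hδ : 0 < δ) (hy : y ∈ Ioc (0 : ℝ) 1) : |y ^ δ| ≤ 1 := by
  rw [abs_of_nonneg (Real.rpow_nonneg hy.1.le _)]
  exact Real.rpow_le_one hy.1.le hy.2 hδ.le

namespace IsDeltaFamily

variable {δ : ℝ} {Θ : Set ℝ} {H : ℝ → Measure ℝ} {h r : ℝ → ℝ → ℝ} {u₀ ε₀ : ℝ}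

/-- Near the origin `H ϑ` has a density `1 + ϑ u^δ + ρ(u)` with `|ρ(u)| ≤ ε |ϑ| u^δ`, uniformly
in `ϑ`, the value `ϑ = 0` included. -/
lemma exists_density (hH : IsDeltaFamily δ Θ H h r u₀ ε₀) {ε : ℝ} (hε : 0 < ε) :
    ∃ η > 0, ∀ ϑ ∈ Θ, |ϑ| ≤ ε₀ → ∃ ρ : ℝ → ℝ,
      AEMeasurable ρ (volume.restrict (Ioc 0 η)) ∧
      (∀ u ∈ Ioc 0 η, |ρ u| ≤ ε * |ϑ| * u ^ δ) ∧
      (∀ u ∈ Ioc 0 η, 0 ≤ 1 + ϑ * u ^ δ + ρ u) ∧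
      (H ϑ).restrict (Ioc 0 η) = (volume.restrict (Ioc 0 η)).withDensity
        (fun u => ENNReal.ofReal (1 + ϑ * u ^ δ + ρ u)) := by
  have h1 := Metric.tendstoUniformlyOn_iff.1 hH.remainder ε hε
  obtain ⟨η₁, hη₁, hsub⟩ := (mem_nhdsGT_iff_exists_Ioc_subset).1 h1
  obtain ⟨hu0, hu1⟩ := hH.u₀_mem
  have hη₁ : 0 < η₁ := hη₁
  refine ⟨min η₁ u₀, lt_min hη₁ hu0, fun ϑ hϑ hϑε => ?_⟩
  have hle : Ioc 0 (min η₁ u₀) ⊆ Icc 0 u₀ := fun u hu =>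
    ⟨hu.1.le, hu.2.trans (min_le_right _ _)⟩
  -- The remainder condition says nothing about `ϑ = 0`; there the uniform law has density exactly
  -- `1`.
  rcases eq_or_ne ϑ 0 with rfl | hne
  · refine ⟨0, aemeasurable_const, by simp, by simp, ?_⟩
    have : Ioc 0 (min η₁ u₀) ⊆ Ioo 0 1 := fun u hu =>
      ⟨hu.1, (hu.2.trans (min_le_right _ _)).trans_lt hu1⟩
    rw [hH.uniform, Measure.restrict_restrict_of_subset this]
    simp
  · have heq : ∀ u ∈ Ioc 0 (min η₁ u₀), h ϑ u = 1 + ϑ * u ^ δ + (h ϑ u - 1 - ϑ * u ^ δ) :=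
      fun u _ => by ring
    -- The remainder is written through `h`, which is the function assumed measurable.
    refine ⟨fun u => h ϑ u - 1 - ϑ * u ^ δ, ?_, fun u hu => ?_, fun u hu => ?_, ?_⟩
    · exact (((hH.density_aemeasurable ϑ hϑ).mono_set hle).sub aemeasurable_const).sub
        (Measurable.aemeasurable (by fun_prop))
    · have h2 := hsub (show u ∈ Ioc 0 η₁ from ⟨hu.1, hu.2.trans (min_le_left _ _)⟩) ϑ
        ⟨hϑ, abs_pos.2 hne, hϑε⟩
      have hpos : 0 < u ^ δ := Real.rpow_pos_of_pos hu.1 _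
      rw [Real.dist_eq, zero_sub, abs_neg, abs_div, abs_mul, abs_of_pos hpos,
        div_lt_iff₀ (mul_pos (abs_pos.2 hne) hpos)] at h2
      beta_reduce
      rw [hH.expansion ϑ hϑ u (hle hu), show 1 + ϑ * u ^ δ + r ϑ u - 1 - ϑ * u ^ δ = r ϑ u by ring]
      linarith
    · rw [← heq u hu]
      exact hH.density_nonneg ϑ hϑ u (hle hu)
    · have h2 := congrArg (fun μ => μ.restrict (Ioc 0 (min η₁ u₀))) (hH.density ϑ hϑ)
      simp only [restrict_withDensity measurableSet_Ioc,
        Measure.restrict_restrict_of_subset hle] at h2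
      rw [h2]
      congr with u
      congr 1
      ring

/-- Substitute `u = b y` in the integral against `1 + ϑ u^δ + ρ(u)`. The `L¹` norm of `ψ` is kept in
the error, because for `ψ = exp(itg/a) - 1` it is of order `1/a` while the sup norm need not be
small. The bound `C` serves integrability only. -/
lemma exists_expansion (hH : IsDeltaFamily δ Θ H h r u₀ ε₀) {ε : ℝ} (hε : 0 < ε) :
    ∃ η > 0, ∀ ϑ ∈ Θ, |ϑ| ≤ ε₀ → ∀ b : ℝ, 0 < b → b ≤ η → ∀ ψ : ℝ → ℂ, Measurable ψ →
      ∀ C : ℝ, (∀ y, ‖ψ y‖ ≤ C) →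
      ‖∫ u, (Ioc 0 b).indicator (fun u => ψ (u / b)) u ∂(H ϑ)
        - (b * (∫ y in Ioc 0 1, ψ y) + (ϑ * b ^ (1 + δ) : ℝ) * ∫ y in Ioc 0 1, ψ y * ((y ^ δ : ℝ) : ℂ))‖
        ≤ ε * |ϑ| * b ^ (1 + δ) * ∫ y in Ioc 0 1, ‖ψ y‖ := by
  obtain ⟨η, hη, hdens⟩ := hH.exists_density hε
  have hδ : 0 < δ := hH.delta_mem.1
  refine ⟨η, hη, fun ϑ hϑ hϑε b hb hbη ψ hψ C hC => ?_⟩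
  obtain ⟨ρ, hρm, hρ, hρ0, hρd⟩ := hdens ϑ hϑ hϑε
  have hsub : Ioc 0 b ⊆ Ioc 0 η := Ioc_subset_Ioc_right hbη
  have hdb : (H ϑ).restrict (Ioc 0 b) = (volume.restrict (Ioc 0 b)).withDensity
        (fun u => ENNReal.ofReal (1 + ϑ * u ^ δ + ρ u)) := by
    have h2 := congrArg (fun μ => μ.restrict (Ioc 0 b)) hρd
    simpa only [restrict_withDensity measurableSet_Ioc,
        Measure.restrict_restrict_of_subset hsub] using h2
  have hρm' : AEMeasurable ρ (volume.restrict (Ioc 0 b)) := hρm.mono_set hsub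
  have hbd : ∀ u ∈ Ioc 0 b, |ρ u| ≤ ε * |ϑ| * b ^ δ := fun u hu =>
    (hρ u (hsub hu)).trans (by gcongr; exacts [hu.1.le, hu.2])
  have hψb : Measurable (fun u => ψ (u / b)) := hψ.comp (measurable_id.div_const b)
  have hψi : IntegrableOn (fun u => ψ (u / b)) (Ioc 0 b) :=
    Integrable.of_bound hψb.aestronglyMeasurable C (ae_of_all _ fun u => hC _)
  have hyi : IntegrableOn (fun u => ψ (u / b) * (((u / b) ^ δ : ℝ) : ℂ)) (Ioc 0 b) := by
    refine Integrable.of_bound (Measurable.aestronglyMeasurable (by fun_prop)) C ?_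
    filter_upwards [ae_restrict_mem measurableSet_Ioc] with u hu
    rw [norm_mul, Complex.norm_real, Real.norm_eq_abs]
    have h1 := rpow_le_one_of_mem_Ioc hδ (y := u / b) ⟨div_pos hu.1 hb, (div_le_one hb).2 hu.2⟩
    exact (mul_le_of_le_one_right (norm_nonneg _) h1).trans (hC _)
  have hρi : IntegrableOn (fun u => ψ (u / b) * (ρ u : ℂ)) (Ioc 0 b) := by
    refine Integrable.of_bound (hψb.aestronglyMeasurable.mul
      (Complex.measurable_ofReal.comp_aemeasurable hρm').aestronglyMeasurable)
      (C * (ε * |ϑ| * b ^ δ)) ?_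
    filter_upwards [ae_restrict_mem measurableSet_Ioc] with u hu
    rw [norm_mul, Complex.norm_real, Real.norm_eq_abs]
    exact mul_le_mul (hC _) (hbd u hu) (abs_nonneg _) ((norm_nonneg _).trans (hC 0))
  have e1 : ∫ u, (Ioc 0 b).indicator (fun u => ψ (u / b)) u ∂(H ϑ)
      = ∫ u in Ioc 0 b, (ψ (u / b) + ((ϑ * b ^ δ : ℝ) : ℂ) * (ψ (u / b) * (((u / b) ^ δ : ℝ) : ℂ))
        + ψ (u / b) * (ρ u : ℂ)) := by
    rw [integral_indicator measurableSet_Ioc, hdb,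
      integral_withDensity_eq_integral_toReal_smul₀ _ (ae_of_all _ fun _ => ENNReal.ofReal_lt_top)]
    · refine setIntegral_congr_fun measurableSet_Ioc fun u hu => ?_
      rw [ENNReal.toReal_ofReal (hρ0 u (hsub hu)), Complex.real_smul,
        Real.div_rpow hu.1.le hb.le]
      have hb' : ((b ^ δ : ℝ) : ℂ) ≠ 0 := by exact_mod_cast (Real.rpow_pos_of_pos hb δ).ne'
      push_cast
      field_simp
    · exact ENNReal.measurable_ofReal.comp_aemeasurable
        ((Measurable.aemeasurable (by fun_prop)).add hρm')
  have e2 : ∫ u, (Ioc 0 b).indicator (fun u => ψ (u / b)) u ∂(H ϑ)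
      - (b * (∫ y in Ioc 0 1, ψ y) + (ϑ * b ^ (1 + δ) : ℝ) * ∫ y in Ioc 0 1, ψ y * ((y ^ δ : ℝ) : ℂ))
      = ∫ u in Ioc 0 b, ψ (u / b) * (ρ u : ℂ) := by
    have h12 : IntegrableOn (fun u => ψ (u / b)
        + ((ϑ * b ^ δ : ℝ) : ℂ) * (ψ (u / b) * (((u / b) ^ δ : ℝ) : ℂ))) (Ioc 0 b) :=
      hψi.add (hyi.const_mul _)
    rw [e1, integral_add h12 hρi, integral_add hψi (hyi.const_mul _),
      integral_const_mul, setIntegral_Ioc_comp_div ψ hb,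
      setIntegral_Ioc_comp_div (fun y => ψ y * ((y ^ δ : ℝ) : ℂ)) hb, Real.rpow_add hb,
      Real.rpow_one, Complex.real_smul, Complex.real_smul]
    push_cast
    ring
  rw [e2]
  calc _ ≤ ∫ u in Ioc 0 b, ε * |ϑ| * b ^ δ * ‖ψ (u / b)‖ := by
        refine norm_integral_le_of_norm_le (hψi.norm.const_mul _) ?_
        filter_upwards [ae_restrict_mem measurableSet_Ioc] with u hu
        rw [norm_mul, Complex.norm_real, Real.norm_eq_abs, mul_comm]
        gcongr
        exact hbd u hu
    _ = _ := by
        rw [integral_const_mul, setIntegral_Ioc_comp_div (fun y => ‖ψ y‖) hb, Real.rpow_add hb,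
          Real.rpow_one, smul_eq_mul]
        ring

end IsDeltaFamily

/-! ### The supremum of the process -/

lemma procX_div {M c : ℝ} (hc : c < 0) (w : ℝ) (z : C(I, ℝ)) (t : I) :
    procX M w z t / c = if z t = 0 then M / c else min (w / -c * (z t)⁻¹) (M / c) := by
  unfold procX
  split_ifs with h
  · rfl
  · have hanti : Antitone fun x : ℝ => x / c := fun x y hxy => (div_le_div_right_of_neg hc).2 hxy
    rw [hanti.map_max]
    congr 1
    field_simp

lemma exists_eq_iInf (z : C(I, ℝ)) : ∃ t, z t = ⨅ s, z s ∧ ∀ s, z t ≤ z s := by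
  obtain ⟨t, -, ht⟩ := isCompact_univ.exists_isMinOn univ_nonempty (map_continuous z).continuousOn
  have ht' : ∀ s, z t ≤ z s := fun s => ht (mem_univ s)
  exact ⟨t, le_antisymm (le_ciInf ht') (ciInf_le ⟨z t, by rintro _ ⟨s, rfl⟩; exact ht' s⟩ t), ht'⟩

lemma exists_eq_iSup (z : C(I, ℝ)) : ∃ t, z t = ⨆ s, z s ∧ ∀ s, z s ≤ z t := by
  obtain ⟨t, -, ht⟩ := isCompact_univ.exists_isMaxOn univ_nonempty (map_continuous z).continuousOn
  have ht' : ∀ s, z s ≤ z t := fun s => ht (mem_univ s)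
  exact ⟨t, le_antisymm (le_ciSup ⟨z t, by rintro _ ⟨s, rfl⟩; exact ht' s⟩ t) (ciSup_le ht'), ht'⟩

/-- The supremum depends on the path only through its minimum and its maximum. -/
lemma supRatio_eq {M c : ℝ} (hc : c < 0) (w : ℝ) (z : C(I, ℝ)) :
    supRatio M c w z = if (⨅ t, z t) ≤ 0 ∧ 0 ≤ ⨆ t, z t then M / c else
      min (max (w / -c * (⨅ t, z t)⁻¹) (w / -c * (⨆ t, z t)⁻¹)) (M / c) := by
  obtain ⟨t₁, h₁, hmin⟩ := exists_eq_iInf z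
  obtain ⟨t₂, h₂, hmax⟩ := exists_eq_iSup z
  have hle : ∀ t, procX M w z t / c ≤ M / c := fun t => by
    rw [procX_div hc]
    split_ifs
    · rfl
    · exact min_le_right _ _
  have hbdd : BddAbove (range fun t => procX M w z t / c) := ⟨M / c, by rintro _ ⟨t, rfl⟩; exact hle t⟩
  rw [← h₁, ← h₂, supRatio]
  split_ifs with h
  -- By the intermediate value theorem the path has a zero, and there the upper bound `M / c` is
  -- attained.
  · obtain ⟨t, ht⟩ : (0 : ℝ) ∈ range z :=
      (isPreconnected_range (map_continuous z)).Icc_subset (mem_range_self t₁) (mem_range_self t₂) h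
    refine le_antisymm (ciSup_le hle) (le_trans ?_ (le_ciSup hbdd t))
    rw [procX_div hc, if_pos ht]
  -- A path without zeros has constant sign, where inversion is antitone; the sign of `w` decides
  -- which extremum of the path counts.
  · have hsign : (∀ t, 0 < z t) ∨ ∀ t, z t < 0 := by
      rcases not_and_or.1 h with h | h
      · exact Or.inl fun t => (not_le.1 h).trans_le (hmin t)
      · exact Or.inr fun t => (hmax t).trans_lt (not_le.1 h)
    have hne : ∀ t, z t ≠ 0 := fun t => hsign.elim (fun h => (h t).ne') (fun h => (h t).ne)
    have hanti : ∀ s t, z s ≤ z t → (z t)⁻¹ ≤ (z s)⁻¹ := fun s t hst => by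
      rcases hsign with h | h
      · exact inv_anti₀ (h s) hst
      · exact (inv_le_inv_of_neg (h t) (h s)).2 hst
    have hval : ∀ t, procX M w z t / c = min (w / -c * (z t)⁻¹) (M / c) := fun t => by
      rw [procX_div hc, if_neg (hne t)]
    refine le_antisymm (ciSup_le fun t => ?_) ?_
    · rw [hval]
      refine min_le_min_right _ ?_
      rcases le_total 0 (w / -c) with hw | hw
      · exact le_max_of_le_left (mul_le_mul_of_nonneg_left (hanti _ _ (hmin t)) hw)
      · exact le_max_of_le_right (mul_le_mul_of_nonpos_left (hanti _ _ (hmax t)) hw)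
    · rw [min_max_distrib_right]
      exact max_le ((hval t₁).symm.le.trans (le_ciSup hbdd t₁))
        ((hval t₂).symm.le.trans (le_ciSup hbdd t₂))

lemma continuous_iInf_path : Continuous fun z : C(I, ℝ) => ⨅ t, z t := by
  have h := (isCompact_univ (X := I)).continuous_sInf (f := fun (z : C(I, ℝ)) t => z t)
    (ContinuousEval.continuous_eval)
  simpa only [image_univ, sInf_range] using h

lemma continuous_iSup_path : Continuous fun z : C(I, ℝ) => ⨆ t, z t := by
  have h := (isCompact_univ (X := I)).continuous_sSup (f := fun (z : C(I, ℝ)) t => z t)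
    (ContinuousEval.continuous_eval)
  simpa only [image_univ, sSup_range] using h

/-- An uncountable supremum becomes a Borel function of `w` and two continuous functionals of the
path. Measurability on the whole space is why `supRatio_eq` admits every sign of `w` and `z`. -/
lemma measurable_supRatio [MeasurableSpace C(I, ℝ)] [BorelSpace C(I, ℝ)] {M c : ℝ} (hc : c < 0) :
    Measurable fun x : ℝ × C(I, ℝ) => supRatio M c x.1 x.2 := by
  have hp : Measurable fun x : ℝ × C(I, ℝ) => ⨅ t, x.2 t :=
    continuous_iInf_path.measurable.comp measurable_snd
  have hq : Measurable fun x : ℝ × C(I, ℝ) => ⨆ t, x.2 t :=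
    continuous_iSup_path.measurable.comp measurable_snd
  simp_rw [supRatio_eq hc]
  refine Measurable.ite ?_ measurable_const (by fun_prop)
  exact (measurableSet_le hp measurable_const).inter (measurableSet_le measurable_const hq)

/-- For `w > 0` and a nonnegative path, the exceedance event and the exceedance itself are those of
`w / (|c| inf z)`. -/
lemma ite_supRatio_eq_indicator {E : Type*} [Zero E] {M c : ℝ} (hc : c < 0)
    (hM : 1 < M / c) {w : ℝ} (hw : 0 < w)
    {z : C(I, ℝ)} (hz : ∀ t, 0 ≤ z t) (ψ : ℝ → E) :
    (if supRatio M c w z ≤ 1 then ψ (supRatio M c w z) else 0)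
      = (Ioc 0 (|c| * ⨅ t, z t)).indicator (fun u => ψ (u / (|c| * ⨅ t, z t))) w := by
  obtain ⟨t₁, h₁, hmin⟩ := exists_eq_iInf z
  obtain ⟨t₂, h₂, hmax⟩ := exists_eq_iSup z
  have hc' : 0 < -c := by linarith
  have hs := supRatio_eq (M := M) hc w z
  rw [← h₁, ← h₂] at hs
  rw [← h₁, abs_of_neg hc]
  -- If the minimum is `0`, the supremum is `M / c > 1` and the interval on the right is empty.
  rcases (hz t₁).eq_or_lt with h0 | h0
  · rw [if_pos ⟨h0.symm.le, hz t₂⟩] at hs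
    rw [hs, if_neg (not_le.2 hM), indicator_of_notMem]
    simp [← h0]
  · have hq : 0 < z t₂ := h0.trans_le (hmax t₁)
    have hmx : max (w / -c * (z t₁)⁻¹) (w / -c * (z t₂)⁻¹) = w / (-c * z t₁) := by
      rw [max_eq_left]
      · field_simp
      · gcongr
        exact hmax t₁
    rw [if_neg (fun h => h0.not_ge h.1), hmx] at hs
    rw [hs]
    by_cases hle : w ≤ -c * z t₁
    · have h3 : w / (-c * z t₁) ≤ 1 := (div_le_one (by positivity)).2 hle
      rw [min_eq_left (h3.trans hM.le), if_pos h3, indicator_of_mem (show w ∈ Ioc 0 (-c * z t₁) from ⟨hw, hle⟩)]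
    · rw [if_neg, indicator_of_notMem (fun h => hle h.2)]
      rw [min_le_iff, not_or, not_le, not_le]
      exact ⟨(one_lt_div (by positivity)).2 (not_le.1 hle), hM⟩

/-! ### The normal distribution function, its quantile function and their integrals -/

lemma one_sub_Phi (x : ℝ) : 1 - Phi x = (gaussianReal 0 1).real (Ioi x) := by
  rw [Phi, ProbabilityTheory.cdf_eq_real, ← compl_Iic, probReal_compl_eq_one_sub measurableSet_Iic]

lemma gaussianReal_real_Ioi (d u : ℝ) : (gaussianReal d 1).real (Ioi u) = 1 - Phi (u - d) := by
  have h : gaussianReal d 1 = (gaussianReal 0 1).map (· + d) := by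
    rw [gaussianReal_map_add_const, zero_add]
  rw [one_sub_Phi, h, map_measureReal_apply (by fun_prop) measurableSet_Ioi]
  congr 1
  ext x
  simp [sub_lt_iff_lt_add]

lemma gaussianReal_real_Iio_neg (d u : ℝ) :
    (gaussianReal (-d) 1).real (Iio (-u)) = 1 - Phi (u - d) := by
  rw [← gaussianReal_real_Ioi, ← gaussianReal_map_neg,
    map_measureReal_apply (by fun_prop) measurableSet_Iio]
  congr 1
  ext x
  simp

lemma strictMono_Phi : StrictMono Phi := by
  intro x y hxy
  refine lt_of_le_of_ne (monotone_cdf _ hxy.le) fun heq => ?_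
  have h1 : (gaussianReal 0 1).real (Ioc x y) = 0 := by
    rw [← Iic_sdiff_Iic, measureReal_sdiff (Iic_subset_Iic.2 hxy.le) measurableSet_Iic,
      ← ProbabilityTheory.cdf_eq_real, ← ProbabilityTheory.cdf_eq_real, sub_eq_zero]
    exact heq.symm
  have h2 : (gaussianReal 0 1) (Ioc x y) = 0 := (measureReal_eq_zero_iff).1 h1
  have h3 := gaussianReal_absolutelyContinuous' 0 one_ne_zero h2
  rw [Real.volume_Ioc, ENNReal.ofReal_eq_zero] at h3
  linarith

lemma continuous_Phi : Continuous Phi := by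
  rw [continuous_iff_continuousAt]
  intro x
  have hmono : Monotone Phi := strictMono_Phi.monotone
  rw [hmono.continuousAt_iff_leftLim_eq_rightLim]
  have h1 : (cdf (gaussianReal 0 1)).measure {x} = 0 := by
    have := nullSingletonClass_gaussianReal (μ := 0) (v := 1) one_ne_zero
    rw [measure_cdf]
    exact measure_singleton x
  rw [StieltjesFunction.measure_singleton, ENNReal.ofReal_eq_zero] at h1
  have h2 : Function.rightLim Phi x = Phi x := (cdf (gaussianReal 0 1)).rightLim_eq x
  have h3 : Function.leftLim Phi x ≤ Phi x := hmono.leftLim_le le_rfl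
  rw [h2]
  exact le_antisymm h3 (sub_nonpos.1 h1)

lemma Phi_mem_Ioo (x : ℝ) : Phi x ∈ Ioo (0 : ℝ) 1 :=
  ⟨(cdf_nonneg _ (x - 1)).trans_lt (strictMono_Phi (by linarith)),
    (strictMono_Phi (show x < x + 1 by linarith)).trans_le (cdf_le_one _ _)⟩

lemma exists_Phi_eq {u : ℝ} (hu : u ∈ Ioo (0 : ℝ) 1) : ∃ x, Phi x = u := by
  obtain ⟨a, ha⟩ := ((tendsto_cdf_atBot (gaussianReal 0 1)).eventually (gt_mem_nhds hu.1)).exists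
  obtain ⟨b, hb⟩ := ((tendsto_cdf_atTop (gaussianReal 0 1)).eventually (lt_mem_nhds hu.2)).exists
  exact mem_range_of_exists_le_of_exists_ge continuous_Phi ⟨a, ha.le⟩ ⟨b, hb.le⟩

lemma PhiInv_Phi (x : ℝ) : PhiInv (Phi x) = x := by
  have : {y | Phi x ≤ Phi y} = Ici x := by
    ext y
    simp [strictMono_Phi.le_iff_le]
  rw [PhiInv, this, csInf_Ici]

lemma PhiInv_of_notMem {u : ℝ} (hu : u ∉ Ioo (0 : ℝ) 1) : PhiInv u = 0 := by
  unfold PhiInv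
  rcases le_or_gt u 0 with h | h
  · have : {x | u ≤ Phi x} = univ := eq_univ_of_forall fun x => h.trans (Phi_mem_Ioo x).1.le
    rw [this, Real.sInf_univ]
  · have : {x | u ≤ Phi x} = ∅ := by
      refine eq_empty_of_forall_notMem fun x hx => ?_
      exact hu ⟨h, lt_of_le_of_lt hx (Phi_mem_Ioo x).2⟩
    rw [this, Real.sInf_empty]

lemma measurable_PhiInv : Measurable PhiInv := by
  refine measurable_of_Iic fun x => ?_
  -- The second part records the default value `0` off `(0,1)`: it contributes everything or
  -- nothing, according to the sign of `x`.
  have : PhiInv ⁻¹' Iic x = (Ioo 0 1 ∩ Iic (Phi x)) ∪ ((Ioo 0 1)ᶜ ∩ {_u : ℝ | (0 : ℝ) ≤ x}) := by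
    ext u
    by_cases hu : u ∈ Ioo (0 : ℝ) 1
    · obtain ⟨y, rfl⟩ := exists_Phi_eq hu
      simp only [mem_preimage, PhiInv_Phi, mem_union, mem_inter_iff, mem_compl_iff, hu, mem_Iic,
        strictMono_Phi.le_iff_le, not_true_eq_false, true_and, false_and, or_false]
    · simp [PhiInv_of_notMem hu, hu]
  rw [this]
  exact (measurableSet_Ioo.inter measurableSet_Iic).union
    (measurableSet_Ioo.compl.inter (MeasurableSet.const _))

/-- The probability integral transform. -/
lemma map_Phi_gaussianReal : (gaussianReal 0 1).map Phi = volume.restrict (Ioc 0 1) := by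
  have hm : Measurable Phi := continuous_Phi.measurable
  have : IsProbabilityMeasure ((gaussianReal 0 1).map Phi) :=
    Measure.isProbabilityMeasure_map hm.aemeasurable
  refine Measure.ext_of_Iic _ _ fun a => ?_
  rw [Measure.map_apply hm measurableSet_Iic, Measure.restrict_apply measurableSet_Iic]
  rcases le_or_gt a 0 with h0 | h0
  · have h1 : Phi ⁻¹' Iic a = ∅ := eq_empty_of_forall_notMem fun x hx =>
      absurd (Phi_mem_Ioo x).1 (not_lt.2 (le_trans hx h0))
    have h2 : Iic a ∩ Ioc 0 1 = ∅ := eq_empty_of_forall_notMem fun x hx =>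
      absurd hx.2.1 (not_lt.2 (le_trans hx.1 h0))
    rw [h1, h2, measure_empty, measure_empty]
  rcases lt_or_ge a 1 with h1 | h1
  · obtain ⟨x, rfl⟩ := exists_Phi_eq ⟨h0, h1⟩
    have h2 : Phi ⁻¹' Iic (Phi x) = Iic x := by
      ext y
      simp [strictMono_Phi.le_iff_le]
    have h3 : Iic (Phi x) ∩ Ioc 0 1 = Ioc 0 (Phi x) := by
      ext y
      simp only [mem_inter_iff, mem_Iic, mem_Ioc]
      exact ⟨fun h => ⟨h.2.1, h.1⟩, fun h => ⟨h.2, h.1, h.2.trans h1.le⟩⟩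
    rw [h2, h3, Real.volume_Ioc, sub_zero, Phi, ofReal_cdf]
  · have h2 : Phi ⁻¹' Iic a = univ :=
      eq_univ_of_forall fun x => (Phi_mem_Ioo x).2.le.trans h1
    have h3 : Iic a ∩ Ioc 0 1 = Ioc 0 1 := inter_eq_right.2 fun y hy => hy.2.trans h1
    rw [h2, h3, measure_univ, Real.volume_Ioc]
    simp

lemma setIntegral_Ioc_eq_integral_Phi {g : ℝ → ℝ} (hg : Measurable g) :
    ∫ y in Ioc 0 1, g y = ∫ x, g (Phi x) ∂(gaussianReal 0 1) := by
  rw [← map_Phi_gaussianReal,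
    integral_map continuous_Phi.measurable.aemeasurable hg.aestronglyMeasurable]

lemma integrable_sq_gaussianReal : Integrable (fun x : ℝ => x ^ 2) (gaussianReal 0 1) :=
  (memLp_id_gaussianReal (μ := 0) (v := 1) 2).integrable_sq

lemma integrable_id_gaussianReal : Integrable (fun x : ℝ => x) (gaussianReal 0 1) :=
  (memLp_id_gaussianReal (μ := 0) (v := 1) 1).integrable (by simp)

lemma integrableOn_PhiInv_sq : IntegrableOn (fun y => PhiInv y ^ 2) (Ioc 0 1) := by
  rw [IntegrableOn, ← map_Phi_gaussianReal,
    integrable_map_measure (measurable_PhiInv.pow_const 2).aestronglyMeasurable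
      continuous_Phi.measurable.aemeasurable]
  simpa [Function.comp_def, PhiInv_Phi] using integrable_sq_gaussianReal

lemma integral_PhiInv_sq : ∫ y in Ioc 0 1, PhiInv y ^ 2 = 1 := by
  rw [setIntegral_Ioc_eq_integral_Phi (measurable_PhiInv.pow_const 2)]
  simp_rw [PhiInv_Phi]
  have h := variance_eq_integral (μ := gaussianReal 0 1) (X := fun x => x) (by fun_prop)
  rw [variance_fun_id_gaussianReal, integral_id_gaussianReal] at h
  simpa using h.symm

lemma integral_PhiInv : ∫ y in Ioc 0 1, PhiInv y = 0 := by
  rw [setIntegral_Ioc_eq_integral_Phi measurable_PhiInv]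
  simp_rw [PhiInv_Phi]
  exact integral_id_gaussianReal

lemma normalInt_eq_integral (δ : ℝ) :
    normalInt δ = ∫ x, x * Phi x ^ δ ∂(gaussianReal 0 1) := by
  rw [integral_gaussianReal_eq_integral_smul one_ne_zero, normalInt]
  congr with x
  rw [phi, smul_eq_mul]
  ring

lemma integral_PhiInv_mul_rpow (δ : ℝ) :
    ∫ y in Ioc 0 1, PhiInv y * y ^ δ = normalInt δ := by
  rw [setIntegral_Ioc_eq_integral_Phi (g := fun y => PhiInv y * y ^ δ)
    (measurable_PhiInv.mul (by fun_prop)), normalInt_eq_integral]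
  simp_rw [PhiInv_Phi]

/-- As the normal mean is `0`, the constant `Φ(0)^δ` may be subtracted from `Φ(x)^δ`. Since `Φ^δ` is
strictly increasing, the new integrand is positive except at `x = 0`. -/
lemma normalInt_pos {δ : ℝ} (hδ : 0 < δ) : 0 < normalInt δ := by
  have hm : Measurable Phi := continuous_Phi.measurable
  have hint : Integrable (fun x => x * Phi x ^ δ) (gaussianReal 0 1) := by
    refine integrable_id_gaussianReal.abs.mono' (Measurable.aestronglyMeasurable (by fun_prop))
      (ae_of_all _ fun x => ?_)
    rw [Real.norm_eq_abs, abs_mul]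
    exact mul_le_of_le_one_right (abs_nonneg _)
      (rpow_le_one_of_mem_Ioc hδ (Ioo_subset_Ioc_self (Phi_mem_Ioo x)))
  have hzero : normalInt δ = ∫ x, x * (Phi x ^ δ - Phi 0 ^ δ) ∂(gaussianReal 0 1) := by
    have h1 : ∀ x : ℝ, x * (Phi x ^ δ - Phi 0 ^ δ) = x * Phi x ^ δ - Phi 0 ^ δ * x := fun x => by
      ring
    simp_rw [h1]
    rw [integral_sub hint (integrable_id_gaussianReal.const_mul _), integral_const_mul,
      integral_id_gaussianReal, mul_zero, sub_zero, normalInt_eq_integral]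
  have hint' : Integrable (fun x => x * (Phi x ^ δ - Phi 0 ^ δ)) (gaussianReal 0 1) := by
    simp_rw [mul_sub]
    exact hint.sub (integrable_id_gaussianReal.mul_const _)
  have hpos : ∀ x : ℝ, x ≠ 0 → 0 < x * (Phi x ^ δ - Phi 0 ^ δ) := fun x hx => by
    rcases lt_or_gt_of_ne hx with h | h
    · exact mul_pos_of_neg_of_neg h (sub_neg.2
        (Real.rpow_lt_rpow (Phi_mem_Ioo x).1.le (strictMono_Phi h) hδ))
    · exact mul_pos h (sub_pos.2 (Real.rpow_lt_rpow (Phi_mem_Ioo 0).1.le (strictMono_Phi h) hδ))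
  have hnonneg : ∀ x : ℝ, 0 ≤ x * (Phi x ^ δ - Phi 0 ^ δ) := fun x => by
    rcases eq_or_ne x 0 with rfl | hx
    · simp
    · exact (hpos x hx).le
  rw [hzero, integral_pos_iff_support_of_nonneg hnonneg hint']
  have : NullSingletonClass (gaussianReal 0 1) := nullSingletonClass_gaussianReal one_ne_zero
  have hsub : ({0}ᶜ : Set ℝ) ⊆ Function.support fun x => x * (Phi x ^ δ - Phi 0 ^ δ) :=
    fun x hx => (hpos x hx).ne'
  refine lt_of_lt_of_le ?_ (measure_mono hsub)
  rw [measure_compl (measurableSet_singleton 0) (measure_ne_top _ _), measure_singleton]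
  simp

/-! ### The constants `A` and `B`, and the expansion for one exceedance -/

section Exceedances

variable [MeasurableSpace C(I, ℝ)] [BorelSpace C(I, ℝ)] {Q : Measure C(I, ℝ)} {m M : ℝ}
  {δ : ℝ} {Θ : Set ℝ} {H : ℝ → Measure ℝ} {h r : ℝ → ℝ → ℝ} {u₀ ε₀ : ℝ}

namespace IsGeneratorLaw

omit [BorelSpace C(I, ℝ)] in
lemma ae_iInf_mem_Icc (hQ : IsGeneratorLaw Q m) : ∀ᵐ z ∂Q, (⨅ t, z t) ∈ Icc 0 m := by
  filter_upwards [hQ.bounded] with z hz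
  obtain ⟨t, ht, -⟩ := exists_eq_iInf z
  rw [← ht]
  exact hz t

lemma integrable_iInf (hQ : IsGeneratorLaw Q m) : Integrable (fun z : C(I, ℝ) => ⨅ t, z t) Q := by
  have := hQ.isProbabilityMeasure
  refine Integrable.of_bound continuous_iInf_path.measurable.aestronglyMeasurable m ?_
  filter_upwards [hQ.ae_iInf_mem_Icc] with z hz
  rw [Real.norm_eq_abs, abs_of_nonneg hz.1]
  exact hz.2

lemma integrable_iInf_rpow (hQ : IsGeneratorLaw Q m) (hδ : 0 < δ) :
    Integrable (fun z : C(I, ℝ) => (⨅ t, z t) ^ (1 + δ)) Q := by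
  have := hQ.isProbabilityMeasure
  refine Integrable.of_bound (continuous_iInf_path.measurable.pow_const _).aestronglyMeasurable
    (m ^ (1 + δ)) ?_
  filter_upwards [hQ.ae_iInf_mem_Icc] with z hz
  rw [Real.norm_eq_abs, abs_of_nonneg (Real.rpow_nonneg hz.1 _)]
  exact Real.rpow_le_rpow hz.1 hz.2 (by linarith)

omit [BorelSpace C(I, ℝ)] in
lemma constB_eq (hQ : IsGeneratorLaw Q m) (hδ : 0 < δ) :
    constB Q δ = ∫ z, (⨅ t, z t) ^ (1 + δ) ∂Q := by
  refine integral_congr_ae ?_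
  filter_upwards [hQ.bounded] with z hz
  obtain ⟨t, ht, hmin⟩ := exists_eq_iInf z
  have hle : ∀ s, z t ^ (1 + δ) ≤ z s ^ (1 + δ) := fun s =>
    Real.rpow_le_rpow (hz t).1 (hmin s) (by linarith)
  rw [← ht]
  exact le_antisymm (ciInf_le ⟨z t ^ (1 + δ), by rintro _ ⟨s, rfl⟩; exact hle s⟩ t) (le_ciInf hle)

omit [BorelSpace C(I, ℝ)] in
lemma constB_nonneg (hQ : IsGeneratorLaw Q m) (hδ : 0 < δ) : 0 ≤ constB Q δ := by
  rw [hQ.constB_eq hδ]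
  refine integral_nonneg_of_ae ?_
  filter_upwards [hQ.ae_iInf_mem_Icc] with z hz
  exact Real.rpow_nonneg hz.1 _

/-- If `B = 0`, then `inf Z = 0` almost surely, hence `A = 0`. Positivity makes the shift of `S`
nonzero, so that the efficiency is defined. -/
lemma constB_pos (hQ : IsGeneratorLaw Q m) (hδ : 0 < δ) (hA : 0 < constA Q) : 0 < constB Q δ := by
  refine (hQ.constB_nonneg hδ).lt_of_ne' fun h0 => hA.ne' ?_
  rw [hQ.constB_eq hδ, integral_eq_zero_iff_of_nonneg_ae ?_ (hQ.integrable_iInf_rpow hδ)] at h0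
  · refine integral_eq_zero_of_ae ?_
    filter_upwards [h0, hQ.ae_iInf_mem_Icc] with z hz hz'
    exact ((Real.rpow_eq_zero_iff_of_nonneg hz'.1).1 hz).1
  · filter_upwards [hQ.ae_iInf_mem_Icc] with z hz
    exact Real.rpow_nonneg hz.1 _

end IsGeneratorLaw

omit [MeasurableSpace C(I, ℝ)] [BorelSpace C(I, ℝ)] in
-- The density on `[0,u₀]` excludes an atom at `0`. The point must be discarded: `w = 0` can be an
-- exceedance but lies outside the interval `Ioc`.
lemma IsDeltaFamily.ae_pos (hH : IsDeltaFamily δ Θ H h r u₀ ε₀) {ϑ : ℝ} (hϑ : ϑ ∈ Θ) :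
    ∀ᵐ w ∂(H ϑ), 0 < w := by
  have h0 : H ϑ {0} = 0 := by
    have h1 := congrArg (fun μ => μ {(0 : ℝ)}) (hH.density ϑ hϑ)
    beta_reduce at h1
    rw [Measure.restrict_apply (measurableSet_singleton 0),
      inter_eq_left.2 (singleton_subset_iff.2 (left_mem_Icc.2 hH.u₀_mem.1.le))] at h1
    rw [h1]
    refine withDensity_absolutelyContinuous _ _ ?_
    simp
  rw [ae_iff]
  have h2 : {w : ℝ | ¬ 0 < w} = Iio 0 ∪ {0} := by
    ext w
    simp [le_iff_lt_or_eq]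
  rw [h2]
  exact measure_union_null (hH.nonneg ϑ hϑ) h0

/-- By Fubini the path may be fixed first. The expansion for `W` applies with `b = |c| inf z ≤ |c| m
≤ η`, and integrating `b` and `b^(1+δ)` over the path produces `A` and `B`. -/
lemma exists_integral_exceedance_expansion (hQ : IsGeneratorLaw Q m)
    (hH : IsDeltaFamily δ Θ H h r u₀ ε₀) {ε : ℝ} (hε : 0 < ε) :
    ∃ η > 0, ∀ ϑ ∈ Θ, |ϑ| ≤ ε₀ → ∀ c < 0, |c| * m ≤ η → 1 < M / c →
      ∀ ψ : ℝ → ℂ, Measurable ψ → ∀ C : ℝ, (∀ y, ‖ψ y‖ ≤ C) →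
      ‖∫ x, (if supRatio M c x.1 x.2 ≤ 1 then ψ (supRatio M c x.1 x.2) else 0) ∂((H ϑ).prod Q)
        - ((|c| * constA Q : ℝ) * (∫ y in Ioc 0 1, ψ y)
          + (ϑ * |c| ^ (1 + δ) * constB Q δ : ℝ) * ∫ y in Ioc 0 1, ψ y * ((y ^ δ : ℝ) : ℂ))‖
        ≤ ε * |ϑ| * |c| ^ (1 + δ) * constB Q δ * ∫ y in Ioc 0 1, ‖ψ y‖ := by
  obtain ⟨η, hη, hexp⟩ := hH.exists_expansion hε
  refine ⟨η, hη, fun ϑ hϑ hϑε c hc hcη hMc ψ hψ C hC => ?_⟩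
  have hδ : 0 < δ := hH.delta_mem.1
  have := hQ.isProbabilityMeasure
  have := hH.isProbabilityMeasure ϑ hϑ
  have hs := measurable_supRatio (M := M) hc
  have hint : Integrable (fun x : ℝ × C(I, ℝ) =>
      if supRatio M c x.1 x.2 ≤ 1 then ψ (supRatio M c x.1 x.2) else 0) ((H ϑ).prod Q) := by
    refine Integrable.of_bound (Measurable.ite (measurableSet_le hs measurable_const)
      (hψ.comp hs) measurable_const).aestronglyMeasurable C (ae_of_all _ fun x => ?_)
    split_ifs
    · exact hC _
    · simpa using (norm_nonneg _).trans (hC 0)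
  have hinner := hint.integral_prod_right
  rw [integral_prod_symm _ hint]
  set K₁ := ∫ y in Ioc 0 1, ψ y
  set K₂ := ∫ y in Ioc 0 1, ψ y * ((y ^ δ : ℝ) : ℂ)
  set K₃ := ∫ y in Ioc 0 1, ‖ψ y‖
  have hrpow : ∀ᵐ z ∂Q, (|c| * ⨅ t, z t) ^ (1 + δ) = |c| ^ (1 + δ) * (⨅ t, z t) ^ (1 + δ) := by
    filter_upwards [hQ.ae_iInf_mem_Icc] with z hz
    exact Real.mul_rpow (abs_nonneg _) hz.1
  have hkey : ∀ᵐ z ∂Q, ‖∫ w, (if supRatio M c w z ≤ 1 then ψ (supRatio M c w z) else 0) ∂(H ϑ)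
      - ((|c| * ⨅ t, z t : ℝ) * K₁
        + (ϑ * |c| ^ (1 + δ) * (⨅ t, z t) ^ (1 + δ) : ℝ) * K₂)‖
      ≤ ε * |ϑ| * |c| ^ (1 + δ) * K₃ * (⨅ t, z t) ^ (1 + δ) := by
    filter_upwards [hQ.bounded, hQ.ae_iInf_mem_Icc, hrpow] with z hz hz' hr
    have e1 : ∫ w, (if supRatio M c w z ≤ 1 then ψ (supRatio M c w z) else 0) ∂(H ϑ)
        = ∫ w, (Ioc 0 (|c| * ⨅ t, z t)).indicator (fun u => ψ (u / (|c| * ⨅ t, z t))) w ∂(H ϑ) := by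
      refine integral_congr_ae ?_
      filter_upwards [hH.ae_pos hϑ] with w hw
      exact ite_supRatio_eq_indicator hc hMc hw (fun t => (hz t).1) ψ
    rw [e1, mul_assoc ϑ, ← hr]
    have hb0 : 0 ≤ |c| * ⨅ t, z t := mul_nonneg (abs_nonneg _) hz'.1
    -- The expansion needs `b > 0`. For `b = 0` the interval is empty and both main terms vanish.
    rcases hb0.eq_or_lt with hb | hb
    · rw [← hb, Ioc_self, Real.zero_rpow (by linarith)]
      simp only [indicator_empty, integral_zero, mul_zero, Complex.ofReal_zero, zero_mul, add_zero,
        sub_zero, norm_zero]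
      have : 0 ≤ K₃ := integral_nonneg fun y => norm_nonneg _
      have := Real.rpow_nonneg hz'.1 (1 + δ)
      positivity
    · refine (hexp ϑ hϑ hϑε _ hb (le_trans ?_ hcη) ψ hψ C hC).trans_eq ?_
      · gcongr
        exact hz'.2
      · rw [hr]
        ring
  have hi1 : Integrable (fun z : C(I, ℝ) => ((|c| * ⨅ t, z t : ℝ) : ℂ) * K₁) Q :=
    ((hQ.integrable_iInf.const_mul _).ofReal).mul_const _
  have hi2 : Integrable (fun z : C(I, ℝ) =>
      ((ϑ * |c| ^ (1 + δ) * (⨅ t, z t) ^ (1 + δ) : ℝ) : ℂ) * K₂) Q :=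
    (((hQ.integrable_iInf_rpow hδ).const_mul _).ofReal).mul_const _
  have e2 : ((|c| * constA Q : ℝ) * K₁ + (ϑ * |c| ^ (1 + δ) * constB Q δ : ℝ) * K₂ : ℂ)
      = ∫ z, ((|c| * ⨅ t, z t : ℝ) * K₁
        + (ϑ * |c| ^ (1 + δ) * (⨅ t, z t) ^ (1 + δ) : ℝ) * K₂) ∂Q := by
    rw [integral_add hi1 hi2, integral_mul_const, integral_mul_const, integral_complex_ofReal,
      integral_complex_ofReal, integral_const_mul, integral_const_mul, ← hQ.constB_eq hδ, constA]
  have hi12 : Integrable (fun z : C(I, ℝ) => ((|c| * ⨅ t, z t : ℝ) : ℂ) * K₁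
      + ((ϑ * |c| ^ (1 + δ) * (⨅ t, z t) ^ (1 + δ) : ℝ) : ℂ) * K₂) Q := hi1.add hi2
  rw [e2, ← integral_sub hinner hi12]
  refine (norm_integral_le_of_norm_le ((hQ.integrable_iInf_rpow hδ).const_mul _) hkey).trans_eq ?_
  rw [integral_const_mul, ← hQ.constB_eq hδ]
  ring

/-! ### Characteristic functions of exceedance sums -/

section Sample

variable {Ω : Type*} [MeasurableSpace Ω] {W : ℕ → Ω → ℝ} {Z : ℕ → Ω → C(I, ℝ)}

lemma measurable_obs (hW : ∀ i, Measurable (W i)) (hZ : ∀ i, Measurable (Z i)) {c : ℝ}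
    (hc : c < 0) (i : ℕ) : Measurable fun ω => obs M c W Z ω i :=
  (measurable_supRatio hc).comp ((hW i).prodMk (hZ i))

omit [BorelSpace C(I, ℝ)] in
lemma IsSample.map_eq {P : Measure Ω} [IsProbabilityMeasure P] {H' : Measure ℝ}
    (hS : IsSample P H' Q W Z) (i : ℕ) : P.map (fun ω => (W i ω, Z i ω)) = H'.prod Q := by
  rw [(indepFun_iff_map_prod_eq_prod_map_map (hS.law_W i).aemeasurable
    (hS.law_Z i).aemeasurable).1 (hS.indep i), (hS.law_W i).map_eq, (hS.law_Z i).map_eq]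

omit [MeasurableSpace C(I, ℝ)] [BorelSpace C(I, ℝ)] [MeasurableSpace Ω] in
lemma sum_exceedances {E : Type*} [AddCommMonoid E] (s : ℕ → ℝ) (n : ℕ) (g : ℝ → E) :
    ∑ i ∈ exceedances s n, g (s i) = ∑ i ∈ Finset.range n, if s i ≤ 1 then g (s i) else 0 := by
  rw [exceedances, Finset.sum_filter]

lemma measurable_sum_exceedances (hW : ∀ i, Measurable (W i)) (hZ : ∀ i, Measurable (Z i)) {c : ℝ}
    (hc : c < 0) {g : ℝ → ℝ} (hg : Measurable g) (n : ℕ) :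
    Measurable fun ω => ∑ i ∈ exceedances (obs M c W Z ω) n, g (obs M c W Z ω i) := by
  simp_rw [sum_exceedances _ n g]
  refine Finset.measurable_fun_sum _ fun i _ => ?_
  have := measurable_obs (M := M) hW hZ hc i
  exact Measurable.ite (measurableSet_le this measurable_const) (hg.comp this) measurable_const

/-- The characteristic function of a single summand, minus one. -/
noncomputable def charIncrement (ρ : Measure (ℝ × C(I, ℝ))) (M c : ℝ) (g : ℝ → ℝ) (a t : ℝ) : ℂ :=
  ∫ x, (if supRatio M c x.1 x.2 ≤ 1 then
    Complex.exp (Complex.I * ((t * g (supRatio M c x.1 x.2) / a : ℝ) : ℂ)) - 1 else 0) ∂ρ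

/-- A non-exceedance contributes `exp 0 = 1`, so subtracting `1` confines the integrand to the
exceedance event. -/
lemma charFun_summand {ρ : Measure (ℝ × C(I, ℝ))} [IsProbabilityMeasure ρ] {c : ℝ} (hc : c < 0)
    {g : ℝ → ℝ} (hg : Measurable g) (a t : ℝ) :
    charFun (ρ.map fun x : ℝ × C(I, ℝ) =>
      if supRatio M c x.1 x.2 ≤ 1 then g (supRatio M c x.1 x.2) / a else 0) t
      = 1 + charIncrement ρ M c g a t := by
  have hs := measurable_supRatio (M := M) hc
  have hset := measurableSet_le hs (measurable_const (a := (1 : ℝ)))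
  have hm : Measurable fun x : ℝ × C(I, ℝ) =>
      if supRatio M c x.1 x.2 ≤ 1 then g (supRatio M c x.1 x.2) / a else 0 :=
    Measurable.ite hset ((hg.comp hs).div_const a) measurable_const
  have hm' : Measurable fun x : ℝ × C(I, ℝ) => if supRatio M c x.1 x.2 ≤ 1 then
      Complex.exp (Complex.I * ((t * g (supRatio M c x.1 x.2) / a : ℝ) : ℂ)) - 1 else 0 :=
    Measurable.ite hset (by have := hg.comp hs; simp only [Function.comp_def] at this; fun_prop)
      measurable_const
  have hint : Integrable (fun x : ℝ × C(I, ℝ) => if supRatio M c x.1 x.2 ≤ 1 then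
      Complex.exp (Complex.I * ((t * g (supRatio M c x.1 x.2) / a : ℝ) : ℂ)) - 1 else 0) ρ := by
    refine Integrable.of_bound hm'.aestronglyMeasurable 2 (ae_of_all _ fun x => ?_)
    split_ifs
    · refine (norm_sub_le _ _).trans ?_
      rw [mul_comm, Complex.norm_exp_ofReal_mul_I]
      norm_num
    · simp
  have h1 : (1 : ℂ) = ∫ _, (1 : ℂ) ∂ρ := by simp
  rw [charFun_apply_real, integral_map hm.aemeasurable (by fun_prop), charIncrement]
  nth_rewrite 1 [h1]
  rw [← integral_add (integrable_const _) hint]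
  congr with x
  split_ifs
  · rw [add_sub_cancel]
    congr 1
    push_cast
    ring
  · simp

/-- The sum over the random index set is a sum of `n` i.i.d. terms that vanish at non-exceedances;
conditioning on `τ` is avoided. -/
lemma IsSample.charFun_exceedance_sum {P : Measure Ω} [IsProbabilityMeasure P] {H' : Measure ℝ}
    [IsProbabilityMeasure H'] [IsProbabilityMeasure Q] (hS : IsSample P H' Q W Z)
    (hW : ∀ i, Measurable (W i)) (hZ : ∀ i, Measurable (Z i))
    {c : ℝ} (hc : c < 0) {g : ℝ → ℝ} (hg : Measurable g) (a b t : ℝ) (n : ℕ) :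
    charFun (P.map fun ω =>
      (∑ i ∈ exceedances (obs M c W Z ω) n, g (obs M c W Z ω i)) / a - b) t
      = (1 + charIncrement (H'.prod Q) M c g a t) ^ n * Complex.exp (-(Complex.I * (t * b : ℝ))) := by
  set F : ℝ × C(I, ℝ) → ℝ := fun x =>
    if supRatio M c x.1 x.2 ≤ 1 then g (supRatio M c x.1 x.2) / a else 0 with hF
  have hs := measurable_supRatio (M := M) hc
  have hFm : Measurable F :=
    Measurable.ite (measurableSet_le hs measurable_const) ((hg.comp hs).div_const a) measurable_const
  have hpair : ∀ i, Measurable fun ω => (W i ω, Z i ω) := fun i => (hW i).prodMk (hZ i)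
  have hXm : ∀ i, Measurable fun ω => F (W i ω, Z i ω) := fun i => hFm.comp (hpair i)
  have hsum : (fun ω => (∑ i ∈ exceedances (obs M c W Z ω) n, g (obs M c W Z ω i)) / a - b)
      = (· + (-b)) ∘ fun ω => ∑ i ∈ Finset.range n, F (W i ω, Z i ω) := by
    ext ω
    simp only [Function.comp, ← sub_eq_add_neg]
    rw [sum_exceedances _ n g, Finset.sum_div]
    congr 1
    refine Finset.sum_congr rfl fun i _ => ?_
    rw [ite_div, zero_div]
    rfl
  have hind : iIndepFun (fun i ω => F (W i ω, Z i ω)) P :=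
    hS.iIndep.comp (fun _ => F) (fun _ => hFm)
  rw [hsum, ← Measure.map_map (by fun_prop) (Finset.measurable_fun_sum _ fun i _ => hXm i),
    charFun_map_add_const, (hind.restrict _).charFun_map_fun_finsetSum_eq_prod
      (fun i _ => (hXm i).aemeasurable), Finset.prod_apply]
  congr 1
  · rw [Finset.prod_congr rfl (g := fun _ => 1 + charIncrement (H'.prod Q) M c g a t),
      Finset.prod_const, Finset.card_range]
    intro i _
    rw [← charFun_summand hc hg, ← hS.map_eq i, Measure.map_map hFm (hpair i)]
    rfl
  · congr 1
    simp
    ring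

end Sample

end Exceedances

/-! ### The limit of powers, and the rates -/

/-- Here `n w_n` may diverge along the imaginary axis; only the difference from `i b_n` converges.
From `b_n = o(√n)` follows `√n w_n → 0`, hence `n ‖w_n‖² → 0`, which permits replacing `(1 + w_n)^n`
by `exp(n w_n)`. -/
lemma tendsto_one_add_pow_mul_exp {w : ℕ → ℂ} {b : ℕ → ℝ} {L : ℂ}
    (hw : ∀ᶠ n in atTop, ‖1 + w n‖ ≤ 1) (hb : Tendsto (fun n : ℕ => b n / √n) atTop (𝓝 0))
    (hz : Tendsto (fun n : ℕ => n * w n - Complex.I * b n) atTop (𝓝 L)) :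
    Tendsto (fun n => (1 + w n) ^ n * Complex.exp (-(Complex.I * b n))) atTop
      (𝓝 (Complex.exp L)) := by
  have hsqrt : Tendsto (fun n : ℕ => 1 / √(n : ℝ)) atTop (𝓝 0) :=
    tendsto_const_nhds.div_atTop (Real.tendsto_sqrt_atTop.comp tendsto_natCast_atTop_atTop)
  have hws : Tendsto (fun n : ℕ => (√(n : ℝ) : ℂ) * w n) atTop (𝓝 0) := by
    have h1 := (hz.mul (Complex.continuous_ofReal.continuousAt.tendsto.comp hsqrt)).add
      ((Complex.continuous_ofReal.continuousAt.tendsto.comp hb).const_mul Complex.I)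
    simp only [Complex.ofReal_zero, mul_zero, add_zero] at h1
    refine h1.congr' ?_
    filter_upwards [eventually_gt_atTop 0] with n hn
    have hn' : (0 : ℝ) < n := by exact_mod_cast hn
    have h2 : (√(n : ℝ) : ℂ) ≠ 0 := by exact_mod_cast (Real.sqrt_pos.2 hn').ne'
    have h3 : (n : ℂ) = (√(n : ℝ) : ℂ) ^ 2 := by
      rw [← Complex.ofReal_pow, Real.sq_sqrt hn'.le, Complex.ofReal_natCast]
    simp only [Function.comp, Complex.ofReal_div, Complex.ofReal_one]
    rw [h3]
    field_simp
    ring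
  have hsmall : ∀ᶠ n in atTop, ‖w n‖ ≤ 1 := by
    filter_upwards [(tendsto_zero_iff_norm_tendsto_zero.1 hws).eventually
      (ge_mem_nhds (show (0 : ℝ) < 1 by norm_num)), eventually_ge_atTop 1] with n hn hn1
    have h1 : 1 ≤ √(n : ℝ) := Real.one_le_sqrt.2 (by exact_mod_cast hn1)
    rw [norm_mul, Complex.norm_real, Real.norm_eq_abs, abs_of_nonneg (Real.sqrt_nonneg _)] at hn
    nlinarith [norm_nonneg (w n)]
  have hdiff : Tendsto (fun n => (1 + w n) ^ n * Complex.exp (-(Complex.I * b n))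
      - Complex.exp (n * w n - Complex.I * b n)) atTop (𝓝 0) := by
    rw [tendsto_zero_iff_norm_tendsto_zero]
    have h1 : Tendsto (fun n : ℕ => ‖(√(n : ℝ) : ℂ) * w n‖ ^ 2) atTop (𝓝 0) := by
      simpa using (tendsto_zero_iff_norm_tendsto_zero.1 hws).pow 2
    refine squeeze_zero' (Eventually.of_forall fun _ => norm_nonneg _) ?_ h1
    filter_upwards [hw, hsmall] with n hn1 hn2
    have h2 : Complex.exp (n * w n - Complex.I * b n)
        = Complex.exp (n * w n) * Complex.exp (-(Complex.I * b n)) := by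
      rw [← Complex.exp_add, sub_eq_add_neg]
    have h3 : ‖Complex.exp (-(Complex.I * b n))‖ = 1 := by
      rw [show -(Complex.I * (b n : ℂ)) = ((-b n : ℝ) : ℂ) * Complex.I by push_cast; ring,
        Complex.norm_exp_ofReal_mul_I]
    rw [h2, ← sub_mul, norm_mul, h3, mul_one]
    refine (norm_one_add_pow_sub_exp_le hn2 hn1 n).trans_eq ?_
    rw [norm_mul, mul_pow, Complex.norm_real, Real.norm_eq_abs, sq_abs, Real.sq_sqrt (by positivity)]
  have hexp := (Complex.continuous_exp.tendsto L).comp hz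
  simpa using hdiff.add hexp

section Rates

variable {δ A : ℝ} {c : ℕ → ℝ}

lemma tendsto_scale (hδ : 0 < δ) (hA : 0 < A) (hc_neg : ∀ n, c n < 0)
    (hc : Tendsto c atTop (𝓝 0))
    (hnc : Tendsto (fun n : ℕ => (n : ℝ) * |c n| ^ (1 + 2 * δ)) atTop atTop) :
    Tendsto (fun n : ℕ => √(n * |c n| * A)) atTop atTop := by
  refine Real.tendsto_sqrt_atTop.comp (Tendsto.atTop_mul_const hA ?_)
  refine tendsto_atTop_mono' _ ?_ hnc
  have hc' : Tendsto (fun n => |c n|) atTop (𝓝 0) := by simpa using hc.abs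
  filter_upwards [hc'.eventually (ge_mem_nhds zero_lt_one)] with n hn
  have h1 : |c n| ^ (1 + 2 * δ) ≤ |c n| ^ (1 : ℝ) :=
    Real.rpow_le_rpow_of_exponent_ge (abs_pos.2 (hc_neg n).ne) hn (by linarith)
  rw [Real.rpow_one] at h1
  gcongr

lemma tendsto_scale_div_sqrt (hc : Tendsto c atTop (𝓝 0)) :
    Tendsto (fun n : ℕ => √(n * |c n| * A) / √n) atTop (𝓝 0) := by
  have h1 : Tendsto (fun n => √(|c n| * A)) atTop (𝓝 0) := by
    have := (Real.continuous_sqrt.tendsto _).comp (hc.abs.mul_const A)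
    rwa [abs_zero, zero_mul, Real.sqrt_zero] at this
  refine h1.congr' ?_
  filter_upwards [eventually_gt_atTop 0] with n hn
  have hn' : (0 : ℝ) < n := by exact_mod_cast hn
  rw [mul_assoc, Real.sqrt_mul hn'.le, mul_div_cancel_left₀ _ (Real.sqrt_pos.2 hn').ne']

lemma tendsto_alternative (ξ : ℝ)
    (hnc : Tendsto (fun n : ℕ => (n : ℝ) * |c n| ^ (1 + 2 * δ)) atTop atTop) :
    Tendsto (alternative δ c ξ) atTop (𝓝 0) :=
  tendsto_const_nhds.div_atTop (Real.tendsto_sqrt_atTop.comp hnc)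

/-- This fixes the scale of the alternatives: the perturbation summed over the sample has exactly
the order of the normalization `a`, so it survives as a finite shift. -/
lemma nat_mul_alternative_mul (hA : 0 < A) (ξ : ℝ) {n : ℕ} (hn : 0 < n) (hcn : c n < 0) :
    n * (alternative δ c ξ n * |c n| ^ (1 + δ)) = ξ / √A * √(n * |c n| * A) := by
  have hn' : (0 : ℝ) < n := by exact_mod_cast hn
  have hx : 0 < |c n| := abs_pos.2 hcn.ne
  have hp : 0 < |c n| ^ δ := Real.rpow_pos_of_pos hx δ
  have hsA : 0 < √A := Real.sqrt_pos.2 hA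
  have hsx : 0 < √(n * |c n|) := Real.sqrt_pos.2 (by positivity)
  have h1 : √(n * |c n| ^ (1 + 2 * δ)) = √(n * |c n|) * |c n| ^ δ := by
    rw [Real.rpow_add hx, Real.rpow_one, two_mul, Real.rpow_add hx, ← mul_assoc, ← pow_two,
      Real.sqrt_mul (by positivity), Real.sqrt_sq hp.le]
  have h2 : (n : ℝ) * |c n| = √(n * |c n|) ^ 2 := (Real.sq_sqrt (by positivity)).symm
  rw [alternative, h1, Real.sqrt_mul (show 0 ≤ (n : ℝ) * |c n| by positivity) A, Real.rpow_add hx, Real.rpow_one]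
  calc _ = ξ * (n * |c n|) / √(n * |c n|) := by field_simp
    _ = ξ * √(n * |c n|) := by
      nth_rewrite 1 [h2]
      field_simp
    _ = _ := by field_simp

end Rates

/-! ### The central limit theorem under local alternatives -/

section LocalAlternatives

variable [MeasurableSpace C(I, ℝ)] [BorelSpace C(I, ℝ)] {Q : Measure C(I, ℝ)} {m M : ℝ}
  {δ : ℝ} {Θ : Set ℝ} {H : ℝ → Measure ℝ} {h r : ℝ → ℝ → ℝ} {u₀ ε₀ : ℝ} {c : ℕ → ℝ}

omit [MeasurableSpace C(I, ℝ)] [BorelSpace C(I, ℝ)] in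
lemma IsDeltaFamily.eventually_alternative_mem (hH : IsDeltaFamily δ Θ H h r u₀ ε₀) (ξ : ℝ)
    (hnc : Tendsto (fun n : ℕ => (n : ℝ) * |c n| ^ (1 + 2 * δ)) atTop atTop) :
    ∀ᶠ n in atTop, alternative δ c ξ n ∈ Θ ∧ |alternative δ c ξ n| ≤ ε₀ := by
  have ht := tendsto_alternative (δ := δ) ξ hnc
  refine (ht.eventually (hH.isOpen.mem_nhds hH.zero_mem)).and ?_
  have h1 : Tendsto (fun n => |alternative δ c ξ n|) atTop (𝓝 0) := by simpa using ht.abs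
  exact h1.eventually (ge_mem_nhds hH.ε₀_pos)

/-- The term with `A` yields the diverging phase `i t a ∫ g` and the Gaussian exponent; the term
with `B` carries one factor `a` less and yields only the shift. -/
lemma tendsto_nat_mul_charIncrement (hQ : IsGeneratorLaw Q m) (hM : M < 0) (hA : 0 < constA Q)
    (hH : IsDeltaFamily δ Θ H h r u₀ ε₀) (hc_neg : ∀ n, c n < 0) (hc : Tendsto c atTop (𝓝 0))
    (hnc : Tendsto (fun n : ℕ => (n : ℝ) * |c n| ^ (1 + 2 * δ)) atTop atTop)
    {g : ℝ → ℝ} (hg : Measurable g) (hg2 : IntegrableOn (fun y => g y ^ 2) (Ioc 0 1)) (ξ t : ℝ) :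
    Tendsto (fun n : ℕ => n * charIncrement ((H (alternative δ c ξ n)).prod Q) M (c n) g
        (√(n * |c n| * constA Q)) t
        - Complex.I * ((t * (√(n * |c n| * constA Q) * ∫ y in Ioc 0 1, g y) : ℝ) : ℂ)) atTop
      (𝓝 (Complex.I * ((t * (ξ * (constB Q δ / √(constA Q)) * ∫ y in Ioc 0 1, g y * y ^ δ) : ℝ) : ℂ)
        - ((t ^ 2 / 2 * ∫ y in Ioc 0 1, g y ^ 2 : ℝ) : ℂ))) := by
  have hδ : 0 < δ := hH.delta_mem.1
  set A := constA Q
  set B := constB Q δ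
  set a : ℕ → ℝ := fun n => √(n * |c n| * A) with ha
  set μ : Measure ℝ := volume.restrict (Ioc 0 1)
  set ψ : ℝ → ℝ → ℂ := fun a y => Complex.exp (Complex.I * ((t * g y / a : ℝ) : ℂ)) - 1 with hψ
  have hat : Tendsto a atTop atTop := tendsto_scale hδ hA hc_neg hc hnc
  have hB : 0 ≤ B := hQ.constB_nonneg hδ
  have hg1 : Integrable g μ :=
    ((memLp_two_iff_integrable_sq hg.aestronglyMeasurable).2 hg2).integrable (by norm_num)
  have hψm : ∀ a, Measurable (ψ a) := fun a => by fun_prop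
  have hψ2 : ∀ a y, ‖ψ a y‖ ≤ 2 := fun a y => by
    refine (norm_sub_le _ _).trans ?_
    rw [mul_comm, Complex.norm_exp_ofReal_mul_I]
    norm_num
  have hψi : ∀ a, Integrable (ψ a) μ := fun a =>
    Integrable.of_bound (hψm a).aestronglyMeasurable 2 (ae_of_all _ (hψ2 a))
  -- the contribution of the expansion
  have hmain : Tendsto (fun n => ((a n ^ 2 : ℝ) : ℂ) * (∫ y, ψ (a n) y ∂μ)
      - Complex.I * ((t * (a n * ∫ y, g y ∂μ) : ℝ) : ℂ)
      + ((ξ / √A * B : ℝ) : ℂ) * (a n * ∫ y, ψ (a n) y * ((y ^ δ : ℝ) : ℂ) ∂μ)) atTop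
      (𝓝 (Complex.I * ((t * (ξ * (B / √A) * ∫ y, g y * y ^ δ ∂μ) : ℝ) : ℂ)
        - ((t ^ 2 / 2 * ∫ y, g y ^ 2 ∂μ : ℝ) : ℂ))) := by
    have h1 := (tendsto_integral_sq_mul_exp_sub hg hg2 t).comp hat
    have h2 := ((tendsto_integral_mul_exp_sub hg hg1 (k := fun y => y ^ δ) (by fun_prop)
      ((ae_restrict_mem measurableSet_Ioc).mono fun y hy => rpow_le_one_of_mem_Ioc hδ hy)
      t).comp hat).const_mul ((ξ / √A * B : ℝ) : ℂ)
    have h3 := h1.add h2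
    refine (h3.congr' ?_).trans_eq ?_
    · filter_upwards [hat.eventually_gt_atTop 0] with n hn
      have hac : (a n : ℂ) ≠ 0 := by exact_mod_cast hn.ne'
      simp only [Function.comp]
      congr 1
      -- The integral of this linear term, times `a²`, is the centring `i t a ∫ g`.
      have h4 : Integrable (fun y => Complex.I * ((t * g y / a n : ℝ) : ℂ)) μ :=
        (((hg1.const_mul t).div_const (a n)).ofReal).const_mul _
      rw [integral_const_mul, integral_sub (hψi (a n)) h4, integral_const_mul,
        integral_complex_ofReal, integral_div, integral_const_mul]
      push_cast
      field_simp
    · congr 1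
      push_cast
      ring
  -- the remainder
  have herr : Tendsto (fun n : ℕ => n * charIncrement ((H (alternative δ c ξ n)).prod Q) M (c n) g
        (a n) t - (((a n ^ 2 : ℝ) : ℂ) * (∫ y, ψ (a n) y ∂μ)
      + ((ξ / √A * B : ℝ) : ℂ) * (a n * ∫ y, ψ (a n) y * ((y ^ δ : ℝ) : ℂ) ∂μ))) atTop (𝓝 0) := by
    rw [Metric.tendsto_atTop']
    intro ε hε
    -- With tolerance `ε / (K + 1)` in the expansion, the total error is at most `ε K / (K + 1) <
    -- ε`.
    set K := |ξ| / √A * B * (|t| * ∫ y, |g y| ∂μ)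
    have hK : 0 ≤ K := by
      have : 0 ≤ ∫ y, |g y| ∂μ := integral_nonneg fun _ => abs_nonneg _
      positivity
    obtain ⟨η, hη, hexp⟩ := exists_integral_exceedance_expansion (M := M) hQ hH
      (show 0 < ε / (K + 1) by positivity)
    have hcm : Tendsto (fun n => |c n| * m) atTop (𝓝 0) := by simpa using hc.abs.mul_const m
    have hev : ∀ᶠ n in atTop, dist (n * charIncrement ((H (alternative δ c ξ n)).prod Q) M (c n) g
        (a n) t - (((a n ^ 2 : ℝ) : ℂ) * (∫ y, ψ (a n) y ∂μ)
      + ((ξ / √A * B : ℝ) : ℂ) * (a n * ∫ y, ψ (a n) y * ((y ^ δ : ℝ) : ℂ) ∂μ))) 0 < ε := by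
      filter_upwards [hH.eventually_alternative_mem ξ hnc, hcm.eventually (ge_mem_nhds hη),
        hc.eventually (lt_mem_nhds hM), hat.eventually_gt_atTop 0, eventually_gt_atTop 0]
        with n hn hcn hMn han hn0
      have h1 := hexp _ hn.1 hn.2 (c n) (hc_neg n) hcn ((one_lt_div_of_neg (hc_neg n)).2 hMn)
        (ψ (a n)) (hψm _) 2 (hψ2 _)
      have h2 := nat_mul_alternative_mul (δ := δ) (c := c) hA ξ hn0 (hc_neg n)
      have h3 : (n : ℝ) * (|c n| * A) = a n ^ 2 := by
        rw [ha]
        simp only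
        rw [Real.sq_sqrt (by positivity), mul_assoc]
      have h4 : (n : ℝ) * (|alternative δ c ξ n| * |c n| ^ (1 + δ)) = |ξ| / √A * a n := by
        have h5 := congrArg abs h2
        rwa [abs_mul, abs_mul, abs_mul, abs_div, abs_of_nonneg (Real.sqrt_nonneg A),
          abs_of_nonneg (Nat.cast_nonneg n), abs_of_nonneg (Real.rpow_nonneg (abs_nonneg _) _),
          abs_of_nonneg (Real.sqrt_nonneg _)] at h5
      have h6 : (n * charIncrement ((H (alternative δ c ξ n)).prod Q) M (c n) g (a n) t
          - (((a n ^ 2 : ℝ) : ℂ) * (∫ y, ψ (a n) y ∂μ)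
            + ((ξ / √A * B : ℝ) : ℂ) * (a n * ∫ y, ψ (a n) y * ((y ^ δ : ℝ) : ℂ) ∂μ)))
          = (n : ℂ) * (charIncrement ((H (alternative δ c ξ n)).prod Q) M (c n) g (a n) t
            - ((|c n| * A : ℝ) * (∫ y, ψ (a n) y ∂μ)
              + (alternative δ c ξ n * |c n| ^ (1 + δ) * B : ℝ)
                * ∫ y, ψ (a n) y * ((y ^ δ : ℝ) : ℂ) ∂μ)) := by
        have h7 : ((n : ℝ) : ℂ) * ((alternative δ c ξ n * |c n| ^ (1 + δ) : ℝ) : ℂ)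
            = ((ξ / √A : ℝ) : ℂ) * (a n : ℂ) := by
          rw [← Complex.ofReal_mul, h2, Complex.ofReal_mul]
        rw [← h3, Complex.ofReal_mul (n : ℝ), Complex.ofReal_mul (ξ / √A) B,
          Complex.ofReal_mul _ B, Complex.ofReal_natCast]
        rw [Complex.ofReal_natCast] at h7
        linear_combination (-(B : ℂ) * ∫ y, ψ (a n) y * ((y ^ δ : ℝ) : ℂ) ∂μ) * (-h7)
      rw [dist_zero_right, h6, norm_mul, Complex.norm_natCast]
      calc _ ≤ (n : ℝ) * (ε / (K + 1) * |alternative δ c ξ n| * |c n| ^ (1 + δ) * B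
              * ∫ y, ‖ψ (a n) y‖ ∂μ) := by
            gcongr
            exact h1
        _ = ε / (K + 1) * (|ξ| / √A * B * (a n * ∫ y, ‖ψ (a n) y‖ ∂μ)) := by
            linear_combination (ε / (K + 1) * B * ∫ y, ‖ψ (a n) y‖ ∂μ) * h4
        _ ≤ ε / (K + 1) * K := by
            refine mul_le_mul_of_nonneg_left (mul_le_mul_of_nonneg_left ?_ (by positivity))
              (by positivity)
            exact mul_integral_norm_exp_sub_le hg1 t han
        _ < ε := by
            rw [div_mul_eq_mul_div, div_lt_iff₀ (by positivity)]
            nlinarith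
    obtain ⟨N, hN⟩ := eventually_atTop.1 hev
    exact ⟨N, fun n hn => hN n hn.le⟩
  have := herr.add hmain
  rw [zero_add] at this
  refine this.congr fun n => ?_
  ring

section Sample

variable {Ω : Type*} [MeasurableSpace Ω] {W : ℕ → Ω → ℝ} {Z : ℕ → Ω → C(I, ℝ)}
  {P : ℝ → Measure Ω} [∀ ϑ, IsProbabilityMeasure (P ϑ)]

/-- Central limit theorem for the sums of a square integrable function of the exceedances, under
the local alternatives. -/
theorem charFunTendsto_exceedance_sum (hQ : IsGeneratorLaw Q m) (hM : M < 0) (hA : 0 < constA Q)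
    (hH : IsDeltaFamily δ Θ H h r u₀ ε₀) (hW : ∀ i, Measurable (W i)) (hZ : ∀ i, Measurable (Z i))
    (hP : ∀ ϑ ∈ Θ, IsSample (P ϑ) (H ϑ) Q W Z) (hc_neg : ∀ n, c n < 0)
    (hc : Tendsto c atTop (𝓝 0))
    (hnc : Tendsto (fun n : ℕ => (n : ℝ) * |c n| ^ (1 + 2 * δ)) atTop atTop)
    {g : ℝ → ℝ} (hg : Measurable g) (hg2 : IntegrableOn (fun y => g y ^ 2) (Ioc 0 1)) (ξ : ℝ)
    {k κ : ℝ} {v : NNReal} (hk : ∫ y in Ioc 0 1, g y = k) (hκ : ∫ y in Ioc 0 1, g y * y ^ δ = κ)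
    (hv : ∫ y in Ioc 0 1, g y ^ 2 = v) :
    CharFunTendsto (fun n => P (alternative δ c ξ n))
      (fun n ω => (∑ i ∈ exceedances (obs M (c n) W Z ω) n, g (obs M (c n) W Z ω i))
        / √(n * |c n| * constA Q) - √(n * |c n| * constA Q) * k)
      (gaussianReal (ξ * (constB Q δ / √(constA Q)) * κ) v) := by
  intro t
  have hQp := hQ.isProbabilityMeasure
  have hmem := hH.eventually_alternative_mem ξ hnc
  have hz := tendsto_nat_mul_charIncrement hQ hM hA hH hc_neg hc hnc hg hg2 ξ t
  rw [hk, hκ, hv] at hz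
  have hb : Tendsto (fun n : ℕ => t * (√(n * |c n| * constA Q) * k) / √n) atTop (𝓝 0) := by
    have := ((tendsto_scale_div_sqrt (A := constA Q) hc).mul_const k).const_mul t
    rw [zero_mul, mul_zero] at this
    refine this.congr fun n => ?_
    ring
  -- The quantity is the characteristic function of a single summand, so it lies in the unit disc.
  have hw : ∀ᶠ n : ℕ in atTop, ‖1 + charIncrement ((H (alternative δ c ξ n)).prod Q) M (c n) g
      (√(n * |c n| * constA Q)) t‖ ≤ 1 := by
    filter_upwards [hmem] with n hn
    have := hH.isProbabilityMeasure _ hn.1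
    rw [← charFun_summand (hc_neg n) hg]
    have hs := measurable_supRatio (M := M) (hc_neg n)
    have : IsProbabilityMeasure (((H (alternative δ c ξ n)).prod Q).map
        fun x : ℝ × C(I, ℝ) => if supRatio M (c n) x.1 x.2 ≤ 1 then
          g (supRatio M (c n) x.1 x.2) / √(n * |c n| * constA Q) else 0) :=
      Measure.isProbabilityMeasure_map (Measurable.ite (measurableSet_le hs measurable_const)
        ((hg.comp hs).div_const _) measurable_const).aemeasurable
    exact norm_charFun_le_one t
  have hlim := tendsto_one_add_pow_mul_exp hw hb hz
  rw [charFun_gaussianReal]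
  refine (hlim.congr' ?_).trans_eq ?_
  · filter_upwards [hmem] with n hn
    have := hH.isProbabilityMeasure _ hn.1
    exact ((hP _ hn.1).charFun_exceedance_sum hW hZ (hc_neg n) hg _ _ t n).symm
  · congr 2
    push_cast
    ring

end Sample

end LocalAlternatives

/-! ### Eventual equality, integrals of powers, power functions -/

section Eventually

variable {Ω : Type*} [MeasurableSpace Ω] {P : ℕ → Measure Ω}

lemma CharFunTendsto.congr {X Y : ℕ → Ω → ℝ} {ν : Measure ℝ} (h : CharFunTendsto P X ν)
    (hXY : ∀ᶠ n in atTop, X n = Y n) : CharFunTendsto P Y ν := fun t =>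
  (h t).congr' (hXY.mono fun n hn => by rw [hn])

lemma NullInProb.congr {X Y : ℕ → Ω → ℝ} (h : NullInProb P X)
    (hXY : ∀ᶠ n in atTop, X n = Y n) : NullInProb P Y := fun ε hε =>
  (h ε hε).congr' (hXY.mono fun n hn => by rw [hn])

end Eventually

lemma setIntegral_Ioc_rpow {s : ℝ} (hs : -1 < s) : ∫ y in Ioc (0 : ℝ) 1, y ^ s = 1 / (s + 1) := by
  rw [← intervalIntegral.integral_of_le zero_le_one, integral_rpow (Or.inl hs), Real.one_rpow,
    Real.zero_rpow (by linarith), sub_zero]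

lemma integrableOn_Ioc_of_bound {f : ℝ → ℝ} (hf : Measurable f) {C : ℝ}
    (hC : ∀ y ∈ Ioc (0 : ℝ) 1, |f y| ≤ C) : IntegrableOn f (Ioc 0 1) :=
  Integrable.of_bound hf.aestronglyMeasurable C
    ((ae_restrict_mem measurableSet_Ioc).mono hC)

lemma integrableOn_Ioc_rpow {δ : ℝ} (hδ : 0 < δ) :
    IntegrableOn (fun y : ℝ => y ^ δ) (Ioc 0 1) :=
  integrableOn_Ioc_of_bound (by fun_prop) fun _ hy => rpow_le_one_of_mem_Ioc hδ hy

lemma setIntegral_Ioc_rpow_mul_rpow {δ : ℝ} (hδ : 0 < δ) :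
    ∫ y in Ioc (0 : ℝ) 1, y ^ δ * y ^ δ = 1 / (2 * δ + 1) := by
  rw [← setIntegral_Ioc_rpow (s := 2 * δ) (by linarith)]
  refine setIntegral_congr_fun measurableSet_Ioc fun y hy => ?_
  rw [← Real.rpow_add hy.1, two_mul]

lemma hasShift_upperPower {Ω : Type*} [MeasurableSpace Ω] {μ : ℕ → Measure Ω}
    [∀ n, IsProbabilityMeasure (μ n)] {stat : ℕ → Ω → ℝ} (hm : ∀ n, Measurable (stat n)) {d : ℝ}
    (h : TendstoInDistribution stat atTop (id : ℝ → ℝ) μ (gaussianReal d 1)) :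
    HasShift (upperPower μ stat) d := by
  intro α _
  have : NullSingletonClass (gaussianReal d 1) := nullSingletonClass_gaussianReal one_ne_zero
  have h1 := tendsto_real_of_tendstoInDistribution hm h (measurableSet_Ioi (a := PhiInv (1 - α)))
    (by rw [frontier_Ioi, measure_singleton])
  rwa [gaussianReal_real_Ioi] at h1

lemma hasShift_lowerPower {Ω : Type*} [MeasurableSpace Ω] {μ : ℕ → Measure Ω}
    [∀ n, IsProbabilityMeasure (μ n)] {stat : ℕ → Ω → ℝ} (hm : ∀ n, Measurable (stat n)) {d : ℝ}
    (h : TendstoInDistribution stat atTop (id : ℝ → ℝ) μ (gaussianReal (-d) 1)) :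
    HasShift (lowerPower μ stat) d := by
  intro α _
  have : NullSingletonClass (gaussianReal (-d) 1) := nullSingletonClass_gaussianReal one_ne_zero
  have h1 := tendsto_real_of_tendstoInDistribution hm h (measurableSet_Iio (a := -PhiInv (1 - α)))
    (by rw [frontier_Iio, measure_singleton])
  rwa [gaussianReal_real_Iio_neg] at h1

/-! ### The statistics as normalized sums -/

section Statistics

variable {M δ A : ℝ} {c : ℕ → ℝ} {Ω : Type*} {W : ℕ → Ω → ℝ} {Z : ℕ → Ω → C(I, ℝ)}

lemma tau_eq_sum (s : ℕ → ℝ) (n : ℕ) : (tau s n : ℝ) = ∑ _i ∈ exceedances s n, (1 : ℝ) := by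
  simp [tau]

/-- The ratio of the deterministic and the random normalization. -/
noncomputable def normRatio (A M : ℝ) (c : ℕ → ℝ) (W : ℕ → Ω → ℝ) (Z : ℕ → Ω → C(I, ℝ)) (n : ℕ)
    (ω : Ω) : ℝ :=
  (√((tau (obs M (c n) W Z ω) n : ℝ) / √(n * |c n| * A) ^ 2))⁻¹

/-- Also true for `τ = 0`, where both sides are `0` because the inverse of `0` is `0`. -/
lemma normRatio_mul_div {n : ℕ} (ha : 0 < √(n * |c n| * A)) (ω : Ω) (x : ℝ) :
    normRatio A M c W Z n ω * (x / √(n * |c n| * A))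
      = 1 / √(tau (obs M (c n) W Z ω) n : ℝ) * x := by
  rw [normRatio, Real.sqrt_div (Nat.cast_nonneg _), Real.sqrt_sq ha.le, inv_div]
  field_simp

/-- The statistic of the optimal tests is a normalized sum up to a remainder governed by
`normRatio`. -/
lemma S_eq {n : ℕ} (hδ : 0 < δ) (ha : 0 < √(n * |c n| * A)) (ω : Ω) :
    S δ A M c W Z n ω
      = ((∑ i ∈ exceedances (obs M (c n) W Z ω) n, √(2 * δ + 1) * obs M (c n) W Z ω i ^ δ)
          / √(n * |c n| * A) - √(n * |c n| * A) * (√(2 * δ + 1) / (1 + δ)))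
        + (normRatio A M c W Z n ω - 1)
          * ((∑ i ∈ exceedances (obs M (c n) W Z ω) n,
            √(2 * δ + 1) * (obs M (c n) W Z ω i ^ δ - 1 / (1 + δ))) / √(n * |c n| * A)
            - √(n * |c n| * A) * 0) := by
  rw [mul_zero, sub_zero, sub_mul, normRatio_mul_div ha, S, optimal, centralOne, centralTwo]
  have ha2 : (n : ℝ) * |c n| * A = √(n * |c n| * A) ^ 2 :=
    (Real.sq_sqrt (Real.sqrt_pos.1 ha).le).symm
  -- If `√τ` is replaced by `a` in `Z_{n2}`, its term `-τ/a` cancels `τ/a` in `Z_{n1}`; only the sum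
  -- of the `Y_k^δ` remains.
  have hsum : ∑ i ∈ exceedances (obs M (c n) W Z ω) n, (obs M (c n) W Z ω i ^ δ - 1 / (1 + δ))
      = ∑ i ∈ exceedances (obs M (c n) W Z ω) n, obs M (c n) W Z ω i ^ δ
        - (tau (obs M (c n) W Z ω) n : ℝ) * (1 / (1 + δ)) := by
    rw [Finset.sum_sub_distrib, Finset.sum_const, nsmul_eq_mul, tau]
  rw [← Finset.mul_sum, ← Finset.mul_sum, hsum]
  nth_rewrite 1 [ha2]
  generalize √(n * |c n| * A) = a at ha
  generalize √(2 * δ + 1) = b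
  generalize ∑ i ∈ exceedances (obs M (c n) W Z ω) n, obs M (c n) W Z ω i ^ δ = x
  generalize (tau (obs M (c n) W Z ω) n : ℝ) = τ
  have h1 : (1 + δ) ≠ 0 := by positivity
  generalize (√τ)⁻¹ = y at *
  simp only [div_eq_mul_inv (1 + δ)]
  field_simp
  ring

variable [MeasurableSpace C(I, ℝ)] [BorelSpace C(I, ℝ)] [MeasurableSpace Ω]

lemma measurable_tau (hW : ∀ i, Measurable (W i)) (hZ : ∀ i, Measurable (Z i)) {c : ℝ}
    (hc : c < 0) (n : ℕ) : Measurable fun ω => (tau (obs M c W Z ω) n : ℝ) := by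
  simp_rw [tau_eq_sum]
  exact measurable_sum_exceedances hW hZ hc (g := fun _ => 1) measurable_const n

lemma measurable_T (hW : ∀ i, Measurable (W i)) (hZ : ∀ i, Measurable (Z i))
    (hc_neg : ∀ n, c n < 0) (n : ℕ) : Measurable (T M c W Z n) := by
  have h1 := measurable_tau (M := M) hW hZ (hc_neg n) n
  have h2 := measurable_sum_exceedances (M := M) hW hZ (hc_neg n) measurable_PhiInv n
  unfold T omnibus
  fun_prop

lemma measurable_S (hW : ∀ i, Measurable (W i)) (hZ : ∀ i, Measurable (Z i))
    (hc_neg : ∀ n, c n < 0) (n : ℕ) : Measurable (S δ A M c W Z n) := by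
  have h1 := measurable_tau (M := M) hW hZ (hc_neg n) n
  have h2 := measurable_sum_exceedances (M := M) hW hZ (hc_neg n)
    (g := fun y => y ^ δ - 1 / (1 + δ)) (by fun_prop) n
  unfold S optimal centralOne centralTwo
  fun_prop

lemma measurable_normRatio (hW : ∀ i, Measurable (W i)) (hZ : ∀ i, Measurable (Z i))
    (hc_neg : ∀ n, c n < 0) (n : ℕ) : Measurable (normRatio A M c W Z n) := by
  have h1 := measurable_tau (M := M) hW hZ (hc_neg n) n
  unfold normRatio
  fun_prop

lemma measurable_normalized_sum (hW : ∀ i, Measurable (W i)) (hZ : ∀ i, Measurable (Z i))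
    (hc_neg : ∀ n, c n < 0) {g : ℝ → ℝ} (hg : Measurable g) (a b : ℝ) (n : ℕ) :
    Measurable fun ω =>
      (∑ i ∈ exceedances (obs M (c n) W Z ω) n, g (obs M (c n) W Z ω i)) / a - b :=
  ((measurable_sum_exceedances hW hZ (hc_neg n) hg n).div_const a).sub_const b

end Statistics

/-! ### Limit laws of the two statistics -/

section Limits

variable [MeasurableSpace C(I, ℝ)] [BorelSpace C(I, ℝ)] {Q : Measure C(I, ℝ)} {m M : ℝ}
  {δ : ℝ} {Θ : Set ℝ} {H : ℝ → Measure ℝ} {h r : ℝ → ℝ → ℝ} {u₀ ε₀ : ℝ} {c : ℕ → ℝ}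
  {Ω : Type*} [MeasurableSpace Ω] {W : ℕ → Ω → ℝ} {Z : ℕ → Ω → C(I, ℝ)}
  {P : ℝ → Measure Ω} [∀ ϑ, IsProbabilityMeasure (P ϑ)]

/-- With `g = 1` the central limit theorem makes `τ/a - a` tight. Dividing by `a → ∞` gives `τ/a² →
1`, and `x ↦ 1/√x` is continuous at `1`. -/
theorem nullInProb_normRatio_sub_one (hQ : IsGeneratorLaw Q m) (hM : M < 0) (hA : 0 < constA Q)
    (hH : IsDeltaFamily δ Θ H h r u₀ ε₀) (hW : ∀ i, Measurable (W i)) (hZ : ∀ i, Measurable (Z i))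
    (hP : ∀ ϑ ∈ Θ, IsSample (P ϑ) (H ϑ) Q W Z) (hc_neg : ∀ n, c n < 0)
    (hc : Tendsto c atTop (𝓝 0))
    (hnc : Tendsto (fun n : ℕ => (n : ℝ) * |c n| ^ (1 + 2 * δ)) atTop atTop) (ξ : ℝ) :
    NullInProb (fun n => P (alternative δ c ξ n))
      (fun n ω => normRatio (constA Q) M c W Z n ω - 1) := by
  have hδ : 0 < δ := hH.delta_mem.1
  have hat := tendsto_scale hδ hA hc_neg hc hnc
  have h1 := charFunTendsto_exceedance_sum hQ hM hA hH hW hZ hP hc_neg hc hnc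
    (g := fun _ => 1) measurable_const (by simp) ξ (k := 1) (κ := 1 / (δ + 1)) (v := 1)
    (by simp) (by simpa using setIntegral_Ioc_rpow (show -1 < δ by linarith)) (by simp)
  have h2 := (nullInProb_of_tendsto (P := fun n => P (alternative δ c ξ n))
    (tendsto_inv_atTop_zero.comp hat)).mul_of_charFunTendsto
      (fun n => measurable_normalized_sum hW hZ hc_neg measurable_const _ _ n) h1
  have h3 : NullInProb (fun n => P (alternative δ c ξ n)) (fun n ω =>
      (tau (obs M (c n) W Z ω) n : ℝ) / √(n * |c n| * constA Q) ^ 2 - 1) := by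
    refine h2.congr ?_
    filter_upwards [hat.eventually_gt_atTop 0] with n hn
    ext ω
    rw [tau_eq_sum]
    simp only [Function.comp]
    field_simp
  have h4 := h3.comp_continuousAt (f := fun x => (√x)⁻¹)
    (Real.continuous_sqrt.continuousAt.inv₀ (by simp))
  simpa only [normRatio, Real.sqrt_one, inv_one] using h4

/-- On `(0,1]` the function `Φ⁻¹` has integral `0` and square integral `1`: no centring appears and
the limit variance is `1`. -/
theorem tendstoInDistribution_T (hQ : IsGeneratorLaw Q m) (hM : M < 0) (hA : 0 < constA Q)
    (hH : IsDeltaFamily δ Θ H h r u₀ ε₀) (hW : ∀ i, Measurable (W i)) (hZ : ∀ i, Measurable (Z i))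
    (hP : ∀ ϑ ∈ Θ, IsSample (P ϑ) (H ϑ) Q W Z) (hc_neg : ∀ n, c n < 0)
    (hc : Tendsto c atTop (𝓝 0))
    (hnc : Tendsto (fun n : ℕ => (n : ℝ) * |c n| ^ (1 + 2 * δ)) atTop atTop) (ξ : ℝ) :
    TendstoInDistribution (T M c W Z) atTop (id : ℝ → ℝ) (fun n => P (alternative δ c ξ n))
      (gaussianReal (ξ * (constB Q δ / √(constA Q)) * normalInt δ) 1) := by
  have hat := tendsto_scale hH.delta_mem.1 hA hc_neg hc hnc
  refine CharFunTendsto.tendstoInDistribution (measurable_T hW hZ hc_neg) ?_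
  have h1 := charFunTendsto_exceedance_sum hQ hM hA hH hW hZ hP hc_neg hc hnc
    measurable_PhiInv integrableOn_PhiInv_sq ξ (v := 1) integral_PhiInv
    (integral_PhiInv_mul_rpow δ) (by simpa using integral_PhiInv_sq)
  have h2 := h1.mul (fun n => measurable_normalized_sum hW hZ hc_neg measurable_PhiInv _ _ n)
    (measurable_normRatio hW hZ hc_neg)
    (nullInProb_normRatio_sub_one hQ hM hA hH hW hZ hP hc_neg hc hnc ξ)
  refine h2.congr ?_
  filter_upwards [hat.eventually_gt_atTop 0] with n hn
  ext ω
  rw [mul_zero, sub_zero, normRatio_mul_div hn, T, omnibus]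

theorem tendstoInDistribution_S (hQ : IsGeneratorLaw Q m) (hM : M < 0) (hA : 0 < constA Q)
    (hH : IsDeltaFamily δ Θ H h r u₀ ε₀) (hW : ∀ i, Measurable (W i)) (hZ : ∀ i, Measurable (Z i))
    (hP : ∀ ϑ ∈ Θ, IsSample (P ϑ) (H ϑ) Q W Z) (hc_neg : ∀ n, c n < 0)
    (hc : Tendsto c atTop (𝓝 0))
    (hnc : Tendsto (fun n : ℕ => (n : ℝ) * |c n| ^ (1 + 2 * δ)) atTop atTop) (ξ : ℝ) :
    TendstoInDistribution (S δ (constA Q) M c W Z) atTop (id : ℝ → ℝ)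
      (fun n => P (alternative δ c ξ n))
      (gaussianReal (ξ * (constB Q δ / √(constA Q)) * (1 / √(2 * δ + 1))) 1) := by
  have hδ : 0 < δ := hH.delta_mem.1
  have hat := tendsto_scale hδ hA hc_neg hc hnc
  have hpos : 0 < 2 * δ + 1 := by linarith
  have hs : 0 < √(2 * δ + 1) := Real.sqrt_pos.2 hpos
  have hs2 : √(2 * δ + 1) ^ 2 = 2 * δ + 1 := Real.sq_sqrt hpos.le
  refine CharFunTendsto.tendstoInDistribution (measurable_S hW hZ hc_neg) ?_
  have hbd : ∀ y ∈ Ioc (0 : ℝ) 1, |y ^ δ| ≤ 1 := fun y hy => rpow_le_one_of_mem_Ioc hδ hy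
  have hm1 : Measurable fun y : ℝ => √(2 * δ + 1) * y ^ δ := by fun_prop
  have hm2 : Measurable fun y : ℝ => √(2 * δ + 1) * (y ^ δ - 1 / (1 + δ)) := by fun_prop
  -- The factor `√(2δ+1)` normalizes the square integral of `y^δ` to `1`.
  have h1 := charFunTendsto_exceedance_sum hQ hM hA hH hW hZ hP hc_neg hc hnc hm1
    (integrableOn_Ioc_of_bound (hm1.pow_const 2) (C := (2 * δ + 1)) fun y hy => by
      rw [abs_pow, abs_mul, mul_pow, sq_abs, hs2]
      exact mul_le_of_le_one_right hpos.le (pow_le_one₀ (abs_nonneg _) (hbd y hy))) ξ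
    (k := √(2 * δ + 1) / (1 + δ)) (κ := 1 / √(2 * δ + 1)) (v := 1)
    (by rw [integral_const_mul, setIntegral_Ioc_rpow (by linarith)]; ring)
    (by
      simp_rw [mul_assoc]
      rw [integral_const_mul, setIntegral_Ioc_rpow_mul_rpow hδ, mul_one_div,
        div_eq_div_iff hpos.ne' hs.ne', ← pow_two, hs2, one_mul])
    (by
      simp_rw [mul_pow, pow_two (_ ^ δ)]
      rw [integral_const_mul, setIntegral_Ioc_rpow_mul_rpow hδ, hs2, NNReal.coe_one]
      field_simp)
  -- This sum is needed only to be tight. Its mean zero removes the diverging centring; shift and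
  -- variance may remain unevaluated integrals.
  have h2 := charFunTendsto_exceedance_sum hQ hM hA hH hW hZ hP hc_neg hc hnc hm2
    (integrableOn_Ioc_of_bound (hm2.pow_const 2) (C := (2 * δ + 1) * 2 ^ 2) fun y hy => by
      have h3 : |1 / (1 + δ)| ≤ 1 := by
        rw [abs_of_pos (by positivity), div_le_one (by positivity)]
        linarith
      rw [abs_pow, abs_mul, mul_pow, sq_abs, hs2]
      gcongr
      refine (abs_sub _ _).trans ?_
      linarith [hbd y hy]) ξ (k := 0)
    (v := (∫ y in Ioc 0 1, (√(2 * δ + 1) * (y ^ δ - 1 / (1 + δ))) ^ 2).toNNReal)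
    (by
      rw [integral_const_mul, integral_sub (integrableOn_Ioc_rpow hδ) (by simp),
        setIntegral_Ioc_rpow (by linarith)]
      simp [add_comm])
    rfl (Real.coe_toNNReal _ (integral_nonneg fun _ => sq_nonneg _)).symm
  have h3 := (nullInProb_normRatio_sub_one hQ hM hA hH hW hZ hP hc_neg hc hnc
    ξ).mul_of_charFunTendsto (fun n => measurable_normalized_sum hW hZ hc_neg hm2 _ _ n) h2
  refine h1.of_sub (fun n => measurable_normalized_sum hW hZ hc_neg hm1 _ _ n)
    (measurable_S hW hZ hc_neg) (h3.congr ?_)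
  filter_upwards [hat.eventually_gt_atTop 0] with n hn
  ext ω
  rw [S_eq hδ hn]
  ring

end Limits

end GPProcess

/-! ### Shifts and asymptotic relative efficiency -/

theorem proposition2p3
    [MeasurableSpace C(unitInterval, ℝ)] [BorelSpace C(unitInterval, ℝ)]
    (Q : Measure C(unitInterval, ℝ)) (m M : ℝ)
    (hQ : GPProcess.IsGeneratorLaw Q m) (hM : M < 0)
    (hA : 0 < GPProcess.constA Q)
    (δ : ℝ) (Θ : Set ℝ) (H : ℝ → Measure ℝ) (h r : ℝ → ℝ → ℝ) (u₀ ε₀ : ℝ)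
    (hH : GPProcess.IsDeltaFamily δ Θ H h r u₀ ε₀)
    {Ω : Type*} [MeasurableSpace Ω]
    (W : ℕ → Ω → ℝ) (Z : ℕ → Ω → C(unitInterval, ℝ))
    (hW : ∀ i, Measurable (W i)) (hZ : ∀ i, Measurable (Z i))
    (P : ℝ → Measure Ω) [∀ ϑ, IsProbabilityMeasure (P ϑ)]
    (hP : ∀ ϑ ∈ Θ, GPProcess.IsSample (P ϑ) (H ϑ) Q W Z)
    (c : ℕ → ℝ) (hc_neg : ∀ n, c n < 0) (hc : Tendsto c atTop (𝓝 0))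
    (hnc : Tendsto (fun n : ℕ => (n : ℝ) * |c n| ^ (1 + 2 * δ)) atTop atTop) :
    (∀ ξ : ℝ,
      TendstoInDistribution (GPProcess.T M c W Z) atTop (id : ℝ → ℝ)
        (fun n => P (GPProcess.alternative δ c ξ n))
        (gaussianReal (ξ * (GPProcess.constB Q δ / √(GPProcess.constA Q))
          * GPProcess.normalInt δ) 1)) ∧
    (∀ ξ : ℝ, 0 ≤ ξ →
      GPProcess.HasShift
        (GPProcess.upperPower (fun n => P (GPProcess.alternative δ c ξ n))
          (GPProcess.T M c W Z))
        (|ξ| * (GPProcess.constB Q δ / √(GPProcess.constA Q)) * GPProcess.normalInt δ) ∧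
      GPProcess.HasShift
        (GPProcess.upperPower (fun n => P (GPProcess.alternative δ c ξ n))
          (GPProcess.S δ (GPProcess.constA Q) M c W Z))
        (|ξ| * GPProcess.constB Q δ / (√(GPProcess.constA Q) * √(2 * δ + 1)))) ∧
    (∀ ξ : ℝ, ξ ≤ 0 →
      GPProcess.HasShift
        (GPProcess.lowerPower (fun n => P (GPProcess.alternative δ c ξ n))
          (GPProcess.T M c W Z))
        (|ξ| * (GPProcess.constB Q δ / √(GPProcess.constA Q)) * GPProcess.normalInt δ) ∧
      GPProcess.HasShift
        (GPProcess.lowerPower (fun n => P (GPProcess.alternative δ c ξ n))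
          (GPProcess.S δ (GPProcess.constA Q) M c W Z))
        (|ξ| * GPProcess.constB Q δ / (√(GPProcess.constA Q) * √(2 * δ + 1)))) ∧
    (∀ ξ : ℝ, 0 < ξ →
      GPProcess.IsARE
        (GPProcess.upperPower (fun n => P (GPProcess.alternative δ c ξ n))
          (GPProcess.T M c W Z))
        (GPProcess.upperPower (fun n => P (GPProcess.alternative δ c ξ n))
          (GPProcess.S δ (GPProcess.constA Q) M c W Z))
        ((2 * δ + 1) * GPProcess.normalInt δ ^ 2)) ∧
    (∀ ξ : ℝ, ξ < 0 →
      GPProcess.IsARE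
        (GPProcess.lowerPower (fun n => P (GPProcess.alternative δ c ξ n))
          (GPProcess.T M c W Z))
        (GPProcess.lowerPower (fun n => P (GPProcess.alternative δ c ξ n))
          (GPProcess.S δ (GPProcess.constA Q) M c W Z))
        ((2 * δ + 1) * GPProcess.normalInt δ ^ 2)) ∧
    0 < (2 * δ + 1) * GPProcess.normalInt δ ^ 2 := by
  have hδ : 0 < δ := hH.delta_mem.1
  have hB := hQ.constB_pos hδ hA
  have hI := GPProcess.normalInt_pos hδ
  have hs : 0 < √(2 * δ + 1) := Real.sqrt_pos.2 (by linarith)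
  have hs2 : √(2 * δ + 1) ^ 2 = 2 * δ + 1 := Real.sq_sqrt (by linarith)
  have hsA : 0 < √(GPProcess.constA Q) := Real.sqrt_pos.2 hA
  have hT := GPProcess.tendstoInDistribution_T hQ hM hA hH hW hZ hP hc_neg hc hnc
  have hS := GPProcess.tendstoInDistribution_S hQ hM hA hH hW hZ hP hc_neg hc hnc
  have hTm := GPProcess.measurable_T (M := M) hW hZ hc_neg
  have hSm := GPProcess.measurable_S (M := M) (δ := δ) (A := GPProcess.constA Q) hW hZ hc_neg
  have hup : ∀ ξ : ℝ, 0 ≤ ξ →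
      GPProcess.HasShift
        (GPProcess.upperPower (fun n => P (GPProcess.alternative δ c ξ n))
          (GPProcess.T M c W Z))
        (|ξ| * (GPProcess.constB Q δ / √(GPProcess.constA Q)) * GPProcess.normalInt δ) ∧
      GPProcess.HasShift
        (GPProcess.upperPower (fun n => P (GPProcess.alternative δ c ξ n))
          (GPProcess.S δ (GPProcess.constA Q) M c W Z))
        (|ξ| * GPProcess.constB Q δ / (√(GPProcess.constA Q) * √(2 * δ + 1))) := by
    intro ξ hξ
    rw [abs_of_nonneg hξ, show ξ * GPProcess.constB Q δ / (√(GPProcess.constA Q) * √(2 * δ + 1))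
      = ξ * (GPProcess.constB Q δ / √(GPProcess.constA Q)) * (1 / √(2 * δ + 1)) by ring]
    exact ⟨GPProcess.hasShift_upperPower hTm (hT ξ), GPProcess.hasShift_upperPower hSm (hS ξ)⟩
  have hlow : ∀ ξ : ℝ, ξ ≤ 0 →
      GPProcess.HasShift
        (GPProcess.lowerPower (fun n => P (GPProcess.alternative δ c ξ n))
          (GPProcess.T M c W Z))
        (|ξ| * (GPProcess.constB Q δ / √(GPProcess.constA Q)) * GPProcess.normalInt δ) ∧
      GPProcess.HasShift
        (GPProcess.lowerPower (fun n => P (GPProcess.alternative δ c ξ n))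
          (GPProcess.S δ (GPProcess.constA Q) M c W Z))
        (|ξ| * GPProcess.constB Q δ / (√(GPProcess.constA Q) * √(2 * δ + 1))) := by
    intro ξ hξ
    rw [abs_of_nonpos hξ]
    -- For `ξ ≤ 0` the limit means are the negatives of the shifts, since `ξ = -|ξ|`.
    refine ⟨GPProcess.hasShift_lowerPower hTm ?_, GPProcess.hasShift_lowerPower hSm ?_⟩
    · rw [show -(-ξ * (GPProcess.constB Q δ / √(GPProcess.constA Q)) * GPProcess.normalInt δ)
        = ξ * (GPProcess.constB Q δ / √(GPProcess.constA Q)) * GPProcess.normalInt δ by ring]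
      exact hT ξ
    · rw [show -(-ξ * GPProcess.constB Q δ / (√(GPProcess.constA Q) * √(2 * δ + 1)))
        = ξ * (GPProcess.constB Q δ / √(GPProcess.constA Q)) * (1 / √(2 * δ + 1)) by ring]
      exact hS ξ
  have hshift : ∀ ξ : ℝ, ξ ≠ 0 →
      |ξ| * GPProcess.constB Q δ / (√(GPProcess.constA Q) * √(2 * δ + 1)) ≠ 0 := fun ξ hξ => by
    have := abs_pos.2 hξ
    positivity
  have hratio : ∀ ξ : ℝ, ξ ≠ 0 → (2 * δ + 1) * GPProcess.normalInt δ ^ 2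
      = (|ξ| * (GPProcess.constB Q δ / √(GPProcess.constA Q)) * GPProcess.normalInt δ) ^ 2
        / (|ξ| * GPProcess.constB Q δ / (√(GPProcess.constA Q) * √(2 * δ + 1))) ^ 2 :=
    fun ξ hξ => by
      have hξ' : |ξ| ≠ 0 := abs_ne_zero.2 hξ
      generalize √(2 * δ + 1) = s at hs hs2 ⊢
      rw [← hs2]
      field_simp
  exact ⟨hT, hup, hlow,
    fun ξ hξ => ⟨_, _, (hup ξ hξ.le).1, (hup ξ hξ.le).2, hshift ξ hξ.ne', hratio ξ hξ.ne'⟩,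
    fun ξ hξ => ⟨_, _, (hlow ξ hξ.le).1, (hlow ξ hξ.le).2, hshift ξ hξ.ne, hratio ξ hξ.ne⟩,
    by positivity⟩
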